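/- A landing market consists of a finite set $A$ of flights, a finite set $S$ of time slots, a capacity $cap(s)\in\{1,2,\dots\}$ for every $s\in S$, a landing window $W(i)\subseteq S$ for every $i\in A$, and delay costs $c_{is}\ge 0$ for $i\in A$, $s\in W(i)$. A landing schedule assigns to every flight $i$ a slot $x(i)\in W(i)$ such that every slot $s$ receives at most $cap(s)$ flights; only markets that have a landing schedule are considered as inputs. A landing schedule $x$ and prices $p_s\ge 0$ ($s\in S$) are an equilibrium if $p_{x(i)}+c_{i\,x(i)}\le p_s+c_{is}$ for all $i\in A$, $s\in W(i)$, and $p_s=0$ for every slot $s$ that receives fewer than $cap(s)$ flights. Let $G$ be the bipartite multigraph with sides $A\cup\{v\}$ ($v$ a new vertex) and $S$, with one edge $(i,s)$ of weight $c_{is}$ for all $i\in A$, $s\in W(i)$, and with $cap(s)$ parallel edges $(v,s)$ of weight $1$ for every $s\in S$. Let $b_i=1$ for $i\in A$, $b_s=cap(s)$ for $s\in S$, and $b_v=\sum_{s\in S}cap(s)-|A|$. A perfect $b$-matching is a set of edges that contains exactly $b_u$ edges at every node $u$. The dual of the matching LP is to maximise $\sum_u b_uq_u$ over $q\in\mathbb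 R^{A\cup\{v\}\cup S}$ subject to $q_u+q_s\le w$ for every edge $(u,s)$ of weight $w$. (1) If the market has a landing schedule, then $G$ has a minimum-weight perfect $b$-matching, and the dual has an optimal solution $q$ with $q_v=1$. For every minimum-weight perfect $b$-matching $F$ and every optimal dual solution $q$ with $q_v=1$, the schedule $x$ with $x(i)=s$ iff $(i,s)\in F$, and the prices $p_s=-q_s$, are an equilibrium. (2) There is a combinatorial, strongly polynomial algorithm that computes, for every landing market that has a landing schedule, an equilibrium landing schedule $x$ and equilibrium prices $p$; moreover $x$ is the schedule of a minimum-weight perfect $b$-matching of $G$ and $p_s=-q_s$ for an optimal dual solution $q$ with $q_v=1$. Here the algorithm is a single program for a random access machine that adds, subtracts, compares and copies numbers (natural numbers, also used as addresses, and real numbers), each in one step; it is combinatorial in that it uses no other operation on numbers. Strongly polynomial means that the number of steps is at most a polynomial in $|A|+|S|$, independent of the values of costs and capacities, and that, for rational costs, all numbers that occur have encoding length at most a polynomial in the encoding length of the market. -/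

import Mathlib

namespace Landing

/-! ### The market -/

/-- A landing market with set of flights `A` and set of time slots `S`.  The value `cost i s` is
meaningful only for `s ∈ window i`; nothing below depends on its other values. -/
structure Market (A S : Type) where
  /-- the landing window of a flight -/
  window : A → Finset S
  /-- the capacity of a slot, a positive integer -/
  cap : S → ℕ
  cap_pos : ∀ s, 0 < cap s
  /-- the delay cost of a flight in a slot of its window -/
  cost : A → S → ℝ
  cost_nonneg : ∀ i, ∀ s ∈ window i, 0 ≤ cost i s

namespace Market

variable {A S : Type} [Fintype A] [Fintype S] (M : Market A S)

open Classical in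
/-- The number of flights that the assignment `x` lands in slot `s`. -/
noncomputable def load (x : A → S) (s : S) : ℕ :=
  (Finset.univ.filter fun i => x i = s).card

/-- A landing schedule: every flight lands in its window, capacities are respected. -/
def IsSchedule (x : A → S) : Prop :=
  (∀ i, x i ∈ M.window i) ∧ ∀ s, load x s ≤ M.cap s

/-- The flights can be scheduled at all. -/
def Feasible : Prop := ∃ x : A → S, M.IsSchedule x

/-- The total cost of flight `i` when it lands in slot `s`, at landing prices `p`. -/
def totalCost (p : S → ℝ) (i : A) (s : S) : ℝ := p s + M.cost i s

/-- `x` and `p` are an equilibrium landing schedule and (nonnegative) equilibrium prices. -/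
structure IsEquilibrium (x : A → S) (p : S → ℝ) : Prop where
  schedule : M.IsSchedule x
  price_nonneg : ∀ s, 0 ≤ p s
  min_cost : ∀ i, ∀ s ∈ M.window i, M.totalCost p i (x i) ≤ M.totalCost p i s
  price_zero : ∀ s, load x s < M.cap s → p s = 0

/-! ### The bipartite multigraph and its perfect `b`-matchings -/

/-- Nodes: the flights together with the special vertex `v` on the left, the slots on the right. -/
abbrev Vertex (A S : Type) := Option A ⊕ S

/-- A flight, as a node. -/
def flightNode (i : A) : Vertex A S := Sum.inl (some i)

/-- The special vertex. -/
def dummy : Vertex A S := Sum.inl none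

/-- A slot, as a node. -/
def slotNode (s : S) : Vertex A S := Sum.inr s

/-- Edges: one edge `(i, s)` for every flight `i` and every slot `s` of its window, and
`cap s` parallel edges `(v, s)` for every slot `s`. -/
abbrev Edge := (Σ i : A, {s : S // s ∈ M.window i}) ⊕ (Σ s : S, Fin (M.cap s))

variable {M} in
/-- The left end of an edge. -/
def Edge.left : M.Edge → Vertex A S
  | Sum.inl e => flightNode e.1
  | Sum.inr _ => dummy

variable {M} in
/-- The right end of an edge. -/
def Edge.right : M.Edge → Vertex A S
  | Sum.inl e => slotNode e.2.1
  | Sum.inr e => slotNode e.1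

variable {M} in
/-- The weight of an edge. -/
def Edge.weight : M.Edge → ℝ
  | Sum.inl e => M.cost e.1 e.2.1
  | Sum.inr _ => 1

/-- The matching requirements. -/
def req : Vertex A S → ℤ
  | Sum.inl (some _) => 1
  | Sum.inl none => (∑ s, (M.cap s : ℤ)) - Fintype.card A
  | Sum.inr s => M.cap s

open Classical in
/-- `F` is a perfect `b`-matching: every node `u` lies on exactly `req u` edges of `F`. -/
def IsPerfectMatching (F : Finset M.Edge) : Prop :=
  ∀ u : Vertex A S, ((F.filter fun e => e.left = u ∨ e.right = u).card : ℤ) = M.req u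

/-- The weight of a set of edges. -/
def weight (F : Finset M.Edge) : ℝ := ∑ e ∈ F, e.weight

/-- `F` is a perfect `b`-matching of minimum weight. -/
def IsMinMatching (F : Finset M.Edge) : Prop :=
  M.IsPerfectMatching F ∧ ∀ F' : Finset M.Edge, M.IsPerfectMatching F' → M.weight F ≤ M.weight F'

/-- Feasibility for the dual of the matching LP (one free variable for every node). -/
def DualFeasible (q : Vertex A S → ℝ) : Prop :=
  ∀ e : M.Edge, q e.left + q e.right ≤ e.weight

/-- The objective, to be maximised, of the dual of the matching LP. -/
def dualValue (q : Vertex A S → ℝ) : ℝ := ∑ u, (M.req u : ℝ) * q u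

/-- `q` is an optimal solution of the dual of the matching LP. -/
def IsDualOptimal (q : Vertex A S → ℝ) : Prop :=
  M.DualFeasible q ∧ ∀ q' : Vertex A S → ℝ, M.DualFeasible q' → M.dualValue q' ≤ M.dualValue q

/-- The assignment `x` is the one that the set `F` of edges describes: flight `i` lands in
slot `s` exactly when the edge `(i, s)` belongs to `F`. -/
def Describes (F : Finset M.Edge) (x : A → S) : Prop :=
  ∀ (i : A) (s : S) (h : s ∈ M.window i), (Sum.inl ⟨i, s, h⟩ : M.Edge) ∈ F ↔ x i = s

end Market

/-! ### The machine model

A random access machine with two kinds of data: natural numbers and real numbers.  Both kinds have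
scalar registers and arrays with two indices, named by natural numbers; arrays are indexed by
natural-number registers.  The only operations on numbers of either kind are copying, addition,
subtraction (truncated for natural numbers) and comparison; no multiplication, division or rounding
is available, and no real constant but `0`.  Every operation and every test takes one step. -/

/-- The contents of the memory. -/
structure Mem where
  /-- natural-number registers -/
  nreg : ℕ → ℕ
  /-- arrays of natural numbers -/
  narr : ℕ → ℕ → ℕ → ℕ
  /-- real registers -/
  rreg : ℕ → ℝ
  /-- arrays of real numbers -/
  rarr : ℕ → ℕ → ℕ → ℝ

/-- Tests: `register x ≤ register y`, for natural and for real registers. -/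
inductive Test where
  | nle (x y : ℕ)
  | rle (x y : ℕ)

/-- Whether a test succeeds. -/
def Test.Holds : Test → Mem → Prop
  | .nle x y, σ => σ.nreg x ≤ σ.nreg y
  | .rle x y, σ => σ.rreg x ≤ σ.rreg y

/-- Statements; a program is a list of statements. -/
inductive Stmt where
  /-- register `x` := the constant `k` -/
  | nconst (x k : ℕ)
  /-- register `x` := register `y` + register `z` -/
  | nadd (x y z : ℕ)
  /-- register `x` := register `y` - register `z`, truncated at `0` -/
  | nsub (x y z : ℕ)
  /-- register `x` := entry of array `a` at the indices in the registers `i`, `j` -/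
  | nload (x a i j : ℕ)
  /-- entry of array `a` at the indices in the registers `i`, `j` := register `x` -/
  | nstore (a i j x : ℕ)
  /-- real register `x` := `0` -/
  | rzero (x : ℕ)
  /-- real register `x` := real register `y` + real register `z` -/
  | radd (x y z : ℕ)
  /-- real register `x` := real register `y` - real register `z` -/
  | rsub (x y z : ℕ)
  /-- real register `x` := entry of real array `a` at the indices in the registers `i`, `j` -/
  | rload (x a i j : ℕ)
  /-- entry of real array `a` at the indices in the registers `i`, `j` := real register `x` -/
  | rstore (a i j x : ℕ)
  /-- conditional -/
  | branch (c : Test) (P Q : List Stmt)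
  /-- repeat `P` as long as the test succeeds -/
  | loop (c : Test) (P : List Stmt)

/-- Programs. -/
abbrev Program := List Stmt

/-- Overwrite one entry of an array. -/
def setEntry {α : Type} (f : ℕ → ℕ → ℕ → α) (a i j : ℕ) (v : α) : ℕ → ℕ → ℕ → α :=
  fun a' i' j' => if a' = a ∧ i' = i ∧ j' = j then v else f a' i' j'

open Classical in
/-- One step of the machine.  A configuration consists of the statements that remain to be
executed and the memory; the machine has halted when no statement remains. -/
noncomputable def step : Program × Mem → Program × Mem
  | ([], σ) => ([], σ)
  | (.nconst x k :: K, σ) => (K, { σ with nreg := Function.update σ.nreg x k })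
  | (.nadd x y z :: K, σ) =>
      (K, { σ with nreg := Function.update σ.nreg x (σ.nreg y + σ.nreg z) })
  | (.nsub x y z :: K, σ) =>
      (K, { σ with nreg := Function.update σ.nreg x (σ.nreg y - σ.nreg z) })
  | (.nload x a i j :: K, σ) =>
      (K, { σ with nreg := Function.update σ.nreg x (σ.narr a (σ.nreg i) (σ.nreg j)) })
  | (.nstore a i j x :: K, σ) =>
      (K, { σ with narr := setEntry σ.narr a (σ.nreg i) (σ.nreg j) (σ.nreg x) })
  | (.rzero x :: K, σ) => (K, { σ with rreg := Function.update σ.rreg x 0 })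
  | (.radd x y z :: K, σ) =>
      (K, { σ with rreg := Function.update σ.rreg x (σ.rreg y + σ.rreg z) })
  | (.rsub x y z :: K, σ) =>
      (K, { σ with rreg := Function.update σ.rreg x (σ.rreg y - σ.rreg z) })
  | (.rload x a i j :: K, σ) =>
      (K, { σ with rreg := Function.update σ.rreg x (σ.rarr a (σ.nreg i) (σ.nreg j)) })
  | (.rstore a i j x :: K, σ) =>
      (K, { σ with rarr := setEntry σ.rarr a (σ.nreg i) (σ.nreg j) (σ.rreg x) })
  | (.branch c P Q :: K, σ) => (if c.Holds σ then P ++ K else Q ++ K, σ)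
  | (.loop c P :: K, σ) => (if c.Holds σ then P ++ .loop c P :: K else K, σ)

/-- The program `P`, started with memory `σ`, halts after at most `t` steps with memory `τ`. -/
def HaltsWith (P : Program) (σ : Mem) (t : ℕ) (τ : Mem) : Prop := step^[t] (P, σ) = ([], τ)

/-! ### Input, output and strong polynomiality -/

/-- The input memory for a market: the registers `0`, `1` hold the numbers of flights and of slots,
array `0` holds the capacities, array `1` the windows (as a `0`-`1` matrix), real array `0` the
delay costs; everything else is `0`. -/
noncomputable def Market.input {n m : ℕ} (M : Market (Fin n) (Fin m)) : Mem where
  nreg x := if x = 0 then n else if x = 1 then m else 0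
  narr a i j :=
    if a = 0 then (if h : i < m ∧ j = 0 then M.cap ⟨i, h.1⟩ else 0)
    else if a = 1 then
      (if h : i < n ∧ j < m then (if ⟨j, h.2⟩ ∈ M.window ⟨i, h.1⟩ then 1 else 0) else 0)
    else 0
  rreg _ := 0
  rarr a i j :=
    if a = 0 then
      (if h : i < n ∧ j < m then
        (if ⟨j, h.2⟩ ∈ M.window ⟨i, h.1⟩ then M.cost ⟨i, h.1⟩ ⟨j, h.2⟩ else 0) else 0)
    else 0

/-- The memory `τ` holds the assignment `x` in array `2` and the prices `p` in real array `1`. -/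
def IsOutput {n m : ℕ} (τ : Mem) (x : Fin n → Fin m) (p : Fin m → ℝ) : Prop :=
  (∀ i : Fin n, τ.narr 2 i 0 = x i) ∧ ∀ s : Fin m, τ.rarr 1 s 0 = p s

/-- The binary encoding length of a rational number. -/
def ratSize (r : ℚ) : ℕ := Nat.size r.num.natAbs + Nat.size r.den + 1

/-- The binary encoding length of a market with the rational delay costs `d`. -/
def Market.size {n m : ℕ} (M : Market (Fin n) (Fin m)) (d : Fin n → Fin m → ℚ) : ℕ :=
  n + m + n * m + ∑ s, Nat.size (M.cap s) + ∑ i, ∑ s ∈ M.window i, ratSize (d i s)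

/-- All numbers in the memory are rational and have encoding length at most `B`. -/
structure Mem.SizeLE (σ : Mem) (B : ℕ) : Prop where
  nreg : ∀ x, Nat.size (σ.nreg x) ≤ B
  narr : ∀ a i j, Nat.size (σ.narr a i j) ≤ B
  rreg : ∀ x, ∃ r : ℚ, σ.rreg x = r ∧ ratSize r ≤ B
  rarr : ∀ a i j, ∃ r : ℚ, σ.rarr a i j = r ∧ ratSize r ≤ B

/-- `P` is strongly polynomial on markets in which a landing schedule exists: the number of steps is
at most a polynomial in the numbers of flights and slots (whatever the costs and the capacities
are), and, when the delay costs are rational, every number that ever occurs has an encoding length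
at most a polynomial in the encoding length of the market. -/
def StronglyPolynomial (P : Program) : Prop :=
  (∃ T : Polynomial ℕ, ∀ (n m : ℕ) (M : Market (Fin n) (Fin m)), M.Feasible →
    ∃ τ, HaltsWith P M.input (T.eval (n + m)) τ) ∧
  ∃ B : Polynomial ℕ, ∀ (n m : ℕ) (M : Market (Fin n) (Fin m)) (d : Fin n → Fin m → ℚ),
    M.Feasible → (∀ i, ∀ s ∈ M.window i, M.cost i s = d i s) →
      ∀ t, (step^[t] (P, M.input)).2.SizeLE (B.eval (M.size d))

end Landing

/-!
An equilibrium is the same thing as a perfect `b`-matching together with a dual solution, normalised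
to `1` at the special vertex, that satisfy complementary slackness.  The edges at the special vertex
say that prices are nonnegative (there is one at every slot, because capacities are positive) and
that they vanish at slots that are not full; the edges at a flight say that its slot minimises its
total cost.  An equilibrium yields a matching and a dual solution of equal value
(`Market.exists_optimal`), and conversely (`Market.exists_equilibrium`).  So strong duality, and with
it the reduction, follows once every market with a landing schedule is known to have an equilibrium.
That is what the algorithm shows.

The algorithm is the Hungarian method.  Flights not yet scheduled sit in a virtual slot `m`, which
has a price too.  Prices and assignment always satisfy the equilibrium conditions (`Partial`).  A
phase grows a tree of slots, rooted at the virtual slot, along pairs of flights and slots in which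
the flight is as well off as where it is.  In each step the prices of all reached slots are raised
by the smallest slack of a pair that leaves the tree, whereupon that pair can be added
(`Partial.grow`).  A pair that leaves the tree exists by a counting argument as in Hall's theorem
(`Partial.exists_candidate`).  When a slot with residual capacity is reached, flights move along the
path from the root (`Partial.move`), and one more flight is scheduled.  Slots in the tree carry
ranks that decrease towards the root, so that paths need not be spoken of.

Programs are verified by symbolic execution with a clock (`Run`), one rule for each statement and
rules for loops with a decreasing measure.  This gives a polynomial bound on the number of steps.
The bound on the length of the numbers comes for free (`stronglyPolynomial_of_time`): the machine only
adds and subtracts, so that each step adds at most one bit, and all real numbers remain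
fractions over the product of the denominators of the costs.

Use of the memory.  Registers: `0`, `1` the numbers `n` of flights and `m` of slots; `2`, `3`, `7` the
constants `1`, `0`, `m + 1`; `4` the phase counter; `5` the current slot; `6` the largest rank; those
from `8` on are scratch.  Arrays: `0` residual capacities, `1` windows, `2` the assignment, `3` ranks,
`4` parents; real arrays: `0` costs, `1` prices.
-/

namespace Landing

/-! ### Symbolic execution of programs -/

namespace Mem

/-- Overwrite a natural-number register. -/
def setN (σ : Mem) (x v : ℕ) : Mem := { σ with nreg := Function.update σ.nreg x v }

/-- Overwrite a real register. -/
noncomputable def setR (σ : Mem) (x : ℕ) (v : ℝ) : Mem :=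
  { σ with rreg := Function.update σ.rreg x v }

/-- Overwrite an entry of an array of natural numbers. -/
def setNA (σ : Mem) (a i j v : ℕ) : Mem := { σ with narr := setEntry σ.narr a i j v }

/-- Overwrite an entry of an array of real numbers. -/
noncomputable def setRA (σ : Mem) (a i j : ℕ) (v : ℝ) : Mem :=
  { σ with rarr := setEntry σ.rarr a i j v }

variable (σ : Mem)

@[simp] theorem nreg_setN (x v y : ℕ) :
    (σ.setN x v).nreg y = if y = x then v else σ.nreg y := by
  simp [setN, Function.update_apply]
@[simp] theorem narr_setN (x v : ℕ) : (σ.setN x v).narr = σ.narr := rfl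
@[simp] theorem rreg_setN (x v : ℕ) : (σ.setN x v).rreg = σ.rreg := rfl
@[simp] theorem rarr_setN (x v : ℕ) : (σ.setN x v).rarr = σ.rarr := rfl
@[simp] theorem nreg_setR (x : ℕ) (v : ℝ) : (σ.setR x v).nreg = σ.nreg := rfl
@[simp] theorem narr_setR (x : ℕ) (v : ℝ) : (σ.setR x v).narr = σ.narr := rfl
@[simp] theorem rarr_setR (x : ℕ) (v : ℝ) : (σ.setR x v).rarr = σ.rarr := rfl
@[simp] theorem rreg_setR (x : ℕ) (v : ℝ) (y : ℕ) :
    (σ.setR x v).rreg y = if y = x then v else σ.rreg y := by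
  simp [setR, Function.update_apply]
@[simp] theorem nreg_setNA (a i j v : ℕ) : (σ.setNA a i j v).nreg = σ.nreg := rfl
@[simp] theorem rarr_setNA (a i j v : ℕ) : (σ.setNA a i j v).rarr = σ.rarr := rfl
@[simp] theorem narr_setNA (a i j v a' i' j' : ℕ) : (σ.setNA a i j v).narr a' i' j' =
    if a' = a ∧ i' = i ∧ j' = j then v else σ.narr a' i' j' := rfl
@[simp] theorem nreg_setRA (a i j : ℕ) (v : ℝ) : (σ.setRA a i j v).nreg = σ.nreg := rfl
@[simp] theorem rreg_setRA (a i j : ℕ) (v : ℝ) : (σ.setRA a i j v).rreg = σ.rreg := rfl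
@[simp] theorem narr_setRA (a i j : ℕ) (v : ℝ) : (σ.setRA a i j v).narr = σ.narr := rfl
@[simp] theorem rarr_setRA (a i j : ℕ) (v : ℝ) (a' i' j' : ℕ) :
    (σ.setRA a i j v).rarr a' i' j' =
      if a' = a ∧ i' = i ∧ j' = j then v else σ.rarr a' i' j' := rfl

end Mem

/-- Total correctness with a clock: started at time `c` with memory `σ`, the program `P` terminates,
at a time and with a memory that satisfy `Q`.  The continuation is arbitrary, so that the
assertion composes. -/
def Run (P : Program) (c : ℕ) (σ : Mem) (Q : ℕ → Mem → Prop) : Prop :=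
  ∃ t τ, (∀ K, step^[t] (P ++ K, σ) = (K, τ)) ∧ Q (c + t) τ

theorem Run.mono {P : Program} {c : ℕ} {σ : Mem} {Q Q' : ℕ → Mem → Prop} (h : Run P c σ Q)
    (hQ : ∀ t τ, Q t τ → Q' t τ) : Run P c σ Q' := by
  obtain ⟨t, τ, h1, h2⟩ := h
  exact ⟨t, τ, h1, hQ _ _ h2⟩

/-- The clock may be started at `0`. -/
theorem Run.shift {P : Program} {c : ℕ} {σ : Mem} {Q : ℕ → Mem → Prop}
    (h : Run P 0 σ fun t τ => Q (c + t) τ) : Run P c σ Q := by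
  obtain ⟨t, τ, h1, h2⟩ := h
  exact ⟨t, τ, h1, by simpa using h2⟩

theorem run_nil {c : ℕ} {σ : Mem} {Q : ℕ → Mem → Prop} (h : Q c σ) : Run [] c σ Q :=
  ⟨0, σ, fun _ => rfl, h⟩

theorem run_append {P R : Program} {c : ℕ} {σ : Mem} {Q : ℕ → Mem → Prop}
    (h : Run P c σ fun t τ => Run R t τ Q) : Run (P ++ R) c σ Q := by
  obtain ⟨t, τ, h1, t', τ', h2, h3⟩ := h
  refine ⟨t' + t, τ', fun K => ?_, by rwa [show c + (t' + t) = c + t + t' by ring]⟩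
  rw [Function.iterate_add_apply, List.append_assoc, h1, h2]

theorem run_step {s : Stmt} {P P' : Program} {c : ℕ} {σ σ' : Mem} {Q : ℕ → Mem → Prop}
    (hs : ∀ K, step (s :: (P ++ K), σ) = (P' ++ K, σ')) (h : Run P' (c + 1) σ' Q) :
    Run (s :: P) c σ Q := by
  obtain ⟨t, τ, h1, h2⟩ := h
  refine ⟨t + 1, τ, fun K => ?_, by rwa [show c + (t + 1) = c + 1 + t by ring]⟩
  rw [Function.iterate_succ_apply, List.cons_append, hs, h1]

section
variable {P : Program} {c : ℕ} {σ : Mem} {Q : ℕ → Mem → Prop}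

theorem run_nconst {x k : ℕ} (h : Run P (c + 1) (σ.setN x k) Q) :
    Run (.nconst x k :: P) c σ Q := run_step (fun _ => rfl) h
theorem run_nadd {x y z : ℕ} (h : Run P (c + 1) (σ.setN x (σ.nreg y + σ.nreg z)) Q) :
    Run (.nadd x y z :: P) c σ Q := run_step (fun _ => rfl) h
theorem run_nsub {x y z : ℕ} (h : Run P (c + 1) (σ.setN x (σ.nreg y - σ.nreg z)) Q) :
    Run (.nsub x y z :: P) c σ Q := run_step (fun _ => rfl) h
theorem run_nload {x a i j : ℕ}
    (h : Run P (c + 1) (σ.setN x (σ.narr a (σ.nreg i) (σ.nreg j))) Q) :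
    Run (.nload x a i j :: P) c σ Q := run_step (fun _ => rfl) h
theorem run_nstore {a i j x : ℕ}
    (h : Run P (c + 1) (σ.setNA a (σ.nreg i) (σ.nreg j) (σ.nreg x)) Q) :
    Run (.nstore a i j x :: P) c σ Q := run_step (fun _ => rfl) h
theorem run_radd {x y z : ℕ} (h : Run P (c + 1) (σ.setR x (σ.rreg y + σ.rreg z)) Q) :
    Run (.radd x y z :: P) c σ Q := run_step (fun _ => rfl) h
theorem run_rsub {x y z : ℕ} (h : Run P (c + 1) (σ.setR x (σ.rreg y - σ.rreg z)) Q) :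
    Run (.rsub x y z :: P) c σ Q := run_step (fun _ => rfl) h
theorem run_rload {x a i j : ℕ}
    (h : Run P (c + 1) (σ.setR x (σ.rarr a (σ.nreg i) (σ.nreg j))) Q) :
    Run (.rload x a i j :: P) c σ Q := run_step (fun _ => rfl) h
theorem run_rstore {a i j x : ℕ}
    (h : Run P (c + 1) (σ.setRA a (σ.nreg i) (σ.nreg j) (σ.rreg x)) Q) :
    Run (.rstore a i j x :: P) c σ Q := run_step (fun _ => rfl) h

theorem run_branch {b : Test} {R R' : Program} (h1 : b.Holds σ → Run (R ++ P) (c + 1) σ Q)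
    (h2 : ¬ b.Holds σ → Run (R' ++ P) (c + 1) σ Q) : Run (.branch b R R' :: P) c σ Q := by
  by_cases hb : b.Holds σ
  · exact run_step (P' := R ++ P) (fun K => by simp [step, hb]) (h1 hb)
  · exact run_step (P' := R' ++ P) (fun K => by simp [step, hb]) (h2 hb)

/-- A loop whose invariant `I` carries a strictly decreasing natural number. -/
theorem run_loop {b : Test} {R : Program} (I : ℕ → Mem → Prop) (B N : ℕ) (hI : I N σ)
    (hR : ∀ k τ, I k τ → b.Holds τ → Run R 0 τ fun t τ' => t ≤ B ∧ ∃ k' < k, I k' τ')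
    (h : ∀ t τ k, t ≤ c + (N * (B + 1) + 1) → I k τ → ¬ b.Holds τ → Run P t τ Q) :
    Run (.loop b R :: P) c σ Q := by
  induction N using Nat.strong_induction_on generalizing c σ with
  | _ N ih =>
  by_cases hb : b.Holds σ
  · refine run_step (P' := R ++ (.loop b R :: P)) (σ' := σ) (fun K => by simp [step, hb]) ?_
    refine run_append ?_
    refine Run.shift ((hR N σ hI hb).mono ?_)
    rintro t τ ⟨ht, k', hk', hI'⟩
    refine ih k' hk' hI' fun t' τ' k ht' hI' hb' => h t' τ' k ?_ hI' hb'
    have : (k' + 1) * (B + 1) ≤ N * (B + 1) := Nat.mul_le_mul_right _ hk'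
    have h2 : (k' + 1) * (B + 1) = k' * (B + 1) + B + 1 := by ring
    omega
  · refine run_step (P' := P) (σ' := σ) (fun K => by simp [step, hb]) ?_
    exact h _ _ N (by omega) hI hb

end

/-- Execute `R` with register `i` running downwards through the numbers below the contents of
register `b`.  Registers `2` and `3` are expected to hold `1` and `0`. -/
def countdown (i b : ℕ) (R : Program) : Program :=
  [.nadd i b 3, .loop (.nle 2 i) (.nsub i i 2 :: R)]

/-- The invariant `I k` of a countdown holds when the numbers `≥ k` have been dealt with. -/
theorem run_countdown {P : Program} {c : ℕ} {σ : Mem} {Q : ℕ → Mem → Prop} {i b : ℕ} {R : Program}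
    (I : ℕ → Mem → Prop) (B N : ℕ) (hN : σ.nreg b = N) (h3 : σ.nreg 3 = 0)
    (hI : I N (σ.setN i N)) (hreg : ∀ k τ, I k τ → τ.nreg i = k ∧ τ.nreg 2 = 1)
    (hR : ∀ k τ, k < N → I (k + 1) τ → Run R 0 (τ.setN i k) fun t τ' => t ≤ B ∧ I k τ')
    (h : ∀ t τ, t ≤ c + (N * (B + 2) + 2) → I 0 τ → Run P t τ Q) :
    Run (countdown i b R ++ P) c σ Q := by
  refine run_nadd ?_
  rw [hN, h3, add_zero]
  refine run_loop (fun k τ => k ≤ N ∧ I k τ) (B + 1) N ⟨le_rfl, hI⟩ ?_ ?_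
  · rintro k τ ⟨hk, hIk⟩ hb
    obtain ⟨h1, h2⟩ := hreg k τ hIk
    simp only [Test.Holds, h1, h2] at hb
    obtain ⟨k, rfl⟩ : ∃ l, k = l + 1 := ⟨k - 1, by omega⟩
    refine run_nsub ?_
    rw [h1, h2, Nat.add_sub_cancel]
    refine Run.shift ((hR k τ (by omega) hIk).mono ?_)
    rintro t τ' ⟨ht, hI'⟩
    exact ⟨by omega, k, by omega, by omega, hI'⟩
  · rintro t τ k ht ⟨hk, hIk⟩ hb
    obtain ⟨h1, h2⟩ := hreg k τ hIk
    simp only [Test.Holds, h1, h2] at hb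
    obtain rfl : k = 0 := by omega
    exact h t τ (by rw [show B + 2 = B + 1 + 1 from rfl]; omega) hIk

/-! ### Partial equilibria and their improvement -/

/-- The number of the first `n` flights that `x` assigns to `s`. -/
def occ (n : ℕ) (x : ℕ → ℕ) (s : ℕ) : ℕ := ((Finset.range n).filter fun j => x j = s).card

theorem occ_update {n j t : ℕ} {x x' : ℕ → ℕ} (hj : j < n)
    (hx : ∀ i, x' i = if i = j then t else x i) (s : ℕ) :
    occ n x' s + (if s = x j then 1 else 0) = occ n x s + if s = t then 1 else 0 := by
  have hj' : j ∈ Finset.range n := Finset.mem_range.2 hj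
  have h : ∑ i ∈ (Finset.range n).erase j, (if x' i = s then 1 else 0)
      = ∑ i ∈ (Finset.range n).erase j, if x i = s then 1 else 0 :=
    Finset.sum_congr rfl fun i hi => by rw [hx, if_neg (Finset.ne_of_mem_erase hi)]
  simp only [occ, Finset.card_filter]
  rw [← Finset.add_sum_erase _ _ hj', ← Finset.add_sum_erase _ (fun i => if x i = s then 1 else 0) hj',
    h, hx, if_pos rfl]
  simp only [eq_comm (a := s)]
  omega

/-- The part of the equilibrium conditions that the algorithm maintains, for flights `j < n` and
slots `s < m`.  The number `m` is an additional virtual slot, which holds the flights not yet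
scheduled and has a price as well; `r` are the residual capacities. -/
structure Partial (n m : ℕ) (w : ℕ → ℕ → ℕ) (c : ℕ → ℕ → ℝ) (x : ℕ → ℕ) (p : ℕ → ℝ)
    (r : ℕ → ℕ) : Prop where
  le : ∀ j < n, x j ≤ m
  window : ∀ j < n, x j < m → 1 ≤ w j (x j)
  nonneg : ∀ s < m, 0 ≤ p s
  price_zero : ∀ s < m, 1 ≤ r s → p s = 0
  min_cost : ∀ j < n, ∀ s < m, 1 ≤ w j s → c j (x j) + p (x j) ≤ c j s + p s

/-- A search tree in the equality graph, rooted at the virtual slot `m`: the reached slots are those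
of positive rank, and slot `s` was reached through flight `par s`, from the slot where that flight
is at present, which has smaller rank.  Only slots of rank at most `b` are looked at. -/
def IsTree (n m : ℕ) (w : ℕ → ℕ → ℕ) (c : ℕ → ℕ → ℝ) (x : ℕ → ℕ) (p : ℕ → ℝ)
    (rk par : ℕ → ℕ) (b : ℕ) : Prop :=
  ∀ s < m, 1 ≤ rk s → rk s ≤ b → par s < n ∧ 1 ≤ w (par s) s ∧ 1 ≤ rk (x (par s)) ∧
    rk (x (par s)) < rk s ∧ c (par s) (x (par s)) + p (x (par s)) = c (par s) s + p s

section
variable {n m : ℕ} {w : ℕ → ℕ → ℕ} {c : ℕ → ℕ → ℝ} {x : ℕ → ℕ} {p : ℕ → ℝ} {r rk par : ℕ → ℕ}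

/-- Moving the parent flight of a slot into that slot. -/
theorem Partial.move {cur : ℕ} {x' : ℕ → ℕ} (h : Partial n m w c x p r)
    (hT : IsTree n m w c x p rk par (rk cur)) (hcur : cur < m) (hrk : 1 ≤ rk cur)
    (hx : ∀ i, x' i = if i = par cur then cur else x i) :
    Partial n m w c x' p r ∧ IsTree n m w c x' p rk par (rk (x (par cur))) := by
  obtain ⟨h1, h2, h3, h4, h5⟩ := hT cur hcur hrk le_rfl
  refine ⟨⟨fun j hj => ?_, fun j hj => ?_, h.nonneg, h.price_zero, fun j hj s hs hw => ?_⟩, ?_⟩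
  · rw [hx]; split_ifs
    · exact hcur.le
    · exact h.le j hj
  · rw [hx]; split_ifs with hjc
    · subst hjc; exact fun _ => h2
    · exact h.window j hj
  · rw [hx]; split_ifs with hjc
    · subst hjc; rw [← h5]; exact h.min_cost _ hj s hs hw
    · exact h.min_cost j hj s hs hw
  · intro s hs hs1 hsb
    obtain ⟨g1, g2, g3, g4, g5⟩ := hT s hs hs1 (by omega)
    -- A slot reached through the moved flight has larger rank than the slot the flight left.
    have hne : par s ≠ par cur := fun he => by rw [he] at g4; omega
    simp only [hx, if_neg hne]
    exact ⟨g1, g2, g3, g4, g5⟩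

/-- The pairs by which a search tree can grow. -/
def Candidate (n m : ℕ) (w : ℕ → ℕ → ℕ) (x rk : ℕ → ℕ) (j s : ℕ) : Prop :=
  j < n ∧ s < m ∧ 1 ≤ rk (x j) ∧ 1 ≤ w j s - rk s

/-- How far a pair is from being an equality. -/
def slack (c : ℕ → ℕ → ℝ) (x : ℕ → ℕ) (p : ℕ → ℝ) (j s : ℕ) : ℝ :=
  c j s + p s - (c j (x j) + p (x j))

/-- Raising the prices of all reached slots by the smallest slack of a candidate, and adding the
slot of that candidate to the tree. -/
theorem Partial.grow {j s b : ℕ} {p' : ℕ → ℝ} {rk' par' : ℕ → ℕ} (h : Partial n m w c x p r)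
    (hw : ∀ j s, w j s ≤ 1)
    (hT : IsTree n m w c x p rk par b) (hb : ∀ s ≤ m, rk s ≤ b)
    (hr : ∀ s < m, 1 ≤ rk s → r s = 0) (hjs : Candidate n m w x rk j s)
    (hmin : ∀ j' s', Candidate n m w x rk j' s' → slack c x p j s ≤ slack c x p j' s')
    (hp : ∀ i ≤ m, p' i = p i + if 1 ≤ rk i then slack c x p j s else 0)
    (hrk : ∀ i, rk' i = if i = s then b + 1 else rk i)
    (hpar : ∀ i, par' i = if i = s then j else par i) :
    Partial n m w c x p' r ∧ IsTree n m w c x p' rk' par' (b + 1) := by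
  obtain ⟨hj, hs, hxj, hws⟩ := hjs
  have hrs : rk s = 0 := by have := hw j s; omega
  have hδ : 0 ≤ slack c x p j s := by
    have := h.min_cost j hj s hs (by omega)
    simp only [slack]; linarith
  have hxne : ∀ i, 1 ≤ rk (x i) → x i ≠ s := fun i hi he => by rw [he] at hi; omega
  refine ⟨⟨h.le, h.window, fun i hi => ?_, fun i hi hri => ?_, fun i hi t ht hwt => ?_⟩, ?_⟩
  · rw [hp i hi.le]
    have := h.nonneg i hi
    split_ifs <;> linarith
  · rw [hp i hi.le, h.price_zero i hi hri, if_neg, add_zero]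
    intro hi'
    have := hr i hi hi'
    omega
  · have h0 := h.min_cost i hi t ht hwt
    rw [hp _ (h.le i hi), hp _ ht.le]
    by_cases h1 : 1 ≤ rk (x i) <;> by_cases h2 : 1 ≤ rk t
    · simp only [h1, h2, if_true]; linarith
    · have := hmin i t ⟨hi, ht, h1, by omega⟩
      simp only [h1, h2, if_true, if_false]
      simp only [slack] at this ⊢
      linarith
    · simp only [h1, h2, if_true, if_false]; linarith
    · simp only [h1, h2, if_false]; linarith
  · intro t ht ht1 htb
    by_cases hts : t = s
    · subst hts
      have h1 : rk' (x j) = rk (x j) := by rw [hrk, if_neg (hxne j hxj)]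
      have := hb (x j) (h.le j hj)
      rw [hpar, if_pos rfl, h1, hrk t, if_pos rfl, hp _ (h.le j hj), hp t ht.le, if_pos hxj,
        if_neg (by omega)]
      refine ⟨hj, by omega, hxj, by omega, ?_⟩
      simp only [slack]; ring
    · rw [hrk, if_neg hts] at ht1
      obtain ⟨g1, g2, g3, g4, g5⟩ := hT t ht ht1 (hb t ht.le)
      have h1 : rk' (x (par t)) = rk (x (par t)) := by rw [hrk, if_neg (hxne _ g3)]
      rw [hpar, if_neg hts, h1, hrk t, if_neg hts, hp _ (h.le _ g1), hp t ht.le, if_pos g3,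
        if_pos ht1]
      exact ⟨g1, g2, g3, g4, by linarith⟩

/-- A Hall-type argument: as long as a flight is in the virtual slot and all reached slots are
full, the tree can grow, because the flights in the reached slots cannot all be scheduled
there. -/
theorem Partial.exists_candidate {cap y : ℕ → ℕ} (h : Partial n m w c x p r)
    (hy : ∀ j < n, y j < m ∧ w j (y j) = 1) (hcap : ∀ s < m, occ n y s ≤ cap s)
    (hbal : ∀ s < m, occ n x s + r s = cap s) (hm : 1 ≤ occ n x m) (hrk : 1 ≤ rk m)
    (hr : ∀ s < m, 1 ≤ rk s → r s = 0) : ∃ j s, Candidate n m w x rk j s := by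
  by_contra! hno
  set J := (Finset.range n).filter fun j => 1 ≤ rk (x j) with hJ
  set R := (Finset.range m).filter fun s => 1 ≤ rk s with hR
  have hmR : m ∉ R := by simp [hR]
  have h1 : J.card = ∑ s ∈ insert m R, (J.filter fun j => x j = s).card := by
    refine Finset.card_eq_sum_card_fiberwise fun j hj => ?_
    simp only [hJ, hR, Finset.coe_filter, Finset.mem_range, Set.mem_ofPred_eq, Finset.coe_insert,
      Set.mem_insert_iff] at hj ⊢
    have := h.le j hj.1
    omega
  have h2 : J.card = ∑ s ∈ R, (J.filter fun j => y j = s).card := by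
    refine Finset.card_eq_sum_card_fiberwise fun j hj => ?_
    simp only [hJ, hR, Finset.coe_filter, Finset.mem_range, Set.mem_ofPred_eq] at hj ⊢
    refine ⟨(hy j hj.1).1, ?_⟩
    by_contra hlt
    have := hy j hj.1
    exact hno j (y j) ⟨hj.1, this.1, hj.2, by omega⟩
  have h3 : ∀ s ∈ insert m R, (J.filter fun j => x j = s).card = occ n x s := by
    intro s hs
    have hs1 : 1 ≤ rk s := by
      rcases Finset.mem_insert.1 hs with rfl | hs
      · exact hrk
      · exact (Finset.mem_filter.1 hs).2
    rw [occ, hJ, Finset.filter_filter]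
    congr 1
    refine Finset.filter_congr fun j _ => ⟨fun h => h.2, fun h => ⟨by rwa [h], h⟩⟩
  rw [Finset.sum_congr rfl h3, Finset.sum_insert hmR] at h1
  have h4 : ∑ s ∈ R, (J.filter fun j => y j = s).card ≤ ∑ s ∈ R, occ n x s := by
    refine Finset.sum_le_sum fun s hs => ?_
    obtain ⟨hs, hs1⟩ := Finset.mem_filter.1 hs
    have hs := Finset.mem_range.1 hs
    have e1 := hcap s hs
    have e2 := hbal s hs
    have e3 := hr s hs hs1
    have e4 : (J.filter fun j => y j = s).card ≤ occ n y s :=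
      Finset.card_le_card (Finset.filter_subset_filter _ (Finset.filter_subset _ _))
    omega
  omega

end

/-! ### The search for the candidate of smallest slack -/

/-- The contents of the registers and arrays that never change after the initialisation. -/
structure Env (n m : ℕ) (w : ℕ → ℕ → ℕ) (c : ℕ → ℕ → ℝ) (σ : Mem) : Prop where
  flights : σ.nreg 0 = n
  slots : σ.nreg 1 = m
  one : σ.nreg 2 = 1
  zero : σ.nreg 3 = 0
  succ : σ.nreg 7 = m + 1
  win : σ.narr 1 = w
  costs : σ.rarr 0 = c

/-- The memories differ at most in scratch registers. -/
structure Same (σ τ : Mem) : Prop where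
  narr : τ.narr = σ.narr
  rarr : τ.rarr = σ.rarr
  nreg : ∀ r < 8, τ.nreg r = σ.nreg r

theorem Env.same {n m : ℕ} {w : ℕ → ℕ → ℕ} {c : ℕ → ℕ → ℝ} {σ τ : Mem} (h : Env n m w c σ)
    (hs : Same σ τ) : Env n m w c τ := by
  obtain ⟨h0, h1, h2, h3, h4, h5, h6⟩ := h
  obtain ⟨g1, g2, g3⟩ := hs
  constructor <;> simp only [Nat.reduceLT, *]

theorem Same.refl (σ : Mem) : Same σ σ := ⟨rfl, rfl, fun _ _ => rfl⟩

theorem Same.setN {σ τ : Mem} (h : Same σ τ) {x : ℕ} (hx : 8 ≤ x) (v : ℕ) :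
    Same σ (τ.setN x v) :=
  ⟨h.narr, h.rarr, fun r hr => by rw [Mem.nreg_setN, if_neg (by omega), h.nreg r hr]⟩

theorem Same.setR {σ τ : Mem} (h : Same σ τ) (x : ℕ) (v : ℝ) : Same σ (τ.setR x v) :=
  ⟨h.narr, h.rarr, h.nreg⟩

/-- The slots of the flights; array `2`. -/
def asg (σ : Mem) (j : ℕ) : ℕ := σ.narr 2 j 0
/-- The prices; real array `1`. -/
def price (σ : Mem) (s : ℕ) : ℝ := σ.rarr 1 s 0
/-- The residual capacities; array `0`. -/
def resid (σ : Mem) (s : ℕ) : ℕ := σ.narr 0 s 0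
/-- The ranks in the search tree; array `3`. -/
def rank (σ : Mem) (s : ℕ) : ℕ := σ.narr 3 s 0
/-- The flights through which slots were reached; array `4`. -/
def parent (σ : Mem) (s : ℕ) : ℕ := σ.narr 4 s 0

/-- Record the pair at hand (flight in register `8`, slot in `9`, slack in real register `2`) as the
best one so far (registers `10`, `11`, real register `0`; register `12` says whether there is
one). -/
def record : Program :=
  [.rzero 4, .radd 0 2 4, .nadd 10 8 3, .nadd 11 9 3, .nadd 12 2 3]

/-- Compare the pair at hand with the best one so far; real register `1` holds the cost plus price
that the flight pays at present. -/
def scanPair : Program :=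
  [.nload 15 1 8 9, .nload 16 3 9 3, .nsub 15 15 16,
    .branch (.nle 2 15)
      [.rload 2 0 8 9, .rload 3 1 9 3, .radd 2 2 3, .rsub 2 2 1,
        .branch (.nle 2 12) [.branch (.rle 0 2) [] record] record] []]

/-- Treat all pairs with the flight in register `8`. -/
def scanRow : Program :=
  [.nload 13 2 8 3, .nload 14 3 13 3,
    .branch (.nle 2 14)
      ([.rload 1 0 8 13, .rload 2 1 13 3, .radd 1 1 2] ++ countdown 9 1 scanPair) []]

/-- Find a candidate of smallest slack. -/
def scan : Program := [.nadd 12 3 3] ++ countdown 8 0 scanRow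

/-- The best candidate among the pairs in `D` has been recorded in `τ`; `σ` is the memory that the
candidates are read from. -/
def Best (n m : ℕ) (w : ℕ → ℕ → ℕ) (c : ℕ → ℕ → ℝ) (σ : Mem) (D : ℕ → ℕ → Prop) (τ : Mem) : Prop :=
  (τ.nreg 12 = 0 ∧ ∀ j s, D j s → ¬ Candidate n m w (asg σ) (rank σ) j s) ∨
  (τ.nreg 12 = 1 ∧ Candidate n m w (asg σ) (rank σ) (τ.nreg 10) (τ.nreg 11) ∧
    τ.rreg 0 = slack c (asg σ) (price σ) (τ.nreg 10) (τ.nreg 11) ∧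
    ∀ j s, D j s → Candidate n m w (asg σ) (rank σ) j s →
      τ.rreg 0 ≤ slack c (asg σ) (price σ) j s)

section
variable {n m : ℕ} {w : ℕ → ℕ → ℕ} {c : ℕ → ℕ → ℝ} {σ τ : Mem} {P : Program} {T : ℕ}
  {Q : ℕ → Mem → Prop}

theorem Best.anti {D D' : ℕ → ℕ → Prop} (h : Best n m w c σ D τ)
    (hD : ∀ j s, D' j s → Candidate n m w (asg σ) (rank σ) j s → D j s) :
    Best n m w c σ D' τ := by
  rcases h with ⟨h1, h2⟩ | ⟨h1, h2, h3, h4⟩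
  · exact .inl ⟨h1, fun j s hj hc => h2 j s (hD j s hj hc) hc⟩
  · exact .inr ⟨h1, h2, h3, fun j s hj hc => h4 j s (hD j s hj hc) hc⟩

theorem Best.congr {D : ℕ → ℕ → Prop} {τ' : Mem} (h : Best n m w c σ D τ)
    (h1 : τ'.nreg 10 = τ.nreg 10) (h2 : τ'.nreg 11 = τ.nreg 11) (h3 : τ'.nreg 12 = τ.nreg 12)
    (h4 : τ'.rreg 0 = τ.rreg 0) : Best n m w c σ D τ' := by
  simpa only [Best, h1, h2, h3, h4] using h

theorem run_record (hE : Env n m w c τ) (hs : Same σ τ)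
    (h : ∀ τ', Same σ τ' → (∀ r < 10, τ'.nreg r = τ.nreg r) → τ'.rreg 1 = τ.rreg 1 →
      τ'.nreg 12 = 1 → τ'.nreg 10 = τ.nreg 8 → τ'.nreg 11 = τ.nreg 9 → τ'.rreg 0 = τ.rreg 2 →
      Run P (T + 5) τ' Q) :
    Run (record ++ P) T τ Q := by
  have h3 := hE.zero
  have h2 := hE.one
  refine run_step (fun _ => rfl) (σ' := τ.setR 4 0) <|
    run_radd <| run_nadd <| run_nadd <| run_nadd ?_
  refine h _ ?_ ?_ ?_ ?_ ?_ ?_ ?_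
  · exact ((((hs.setR _ _).setR _ _).setN (by norm_num) _).setN (by norm_num) _).setN
      (by norm_num) _
  · intro r hr
    simp only [Mem.nreg_setN, Mem.nreg_setR]
    rw [if_neg (by omega), if_neg (by omega), if_neg (by omega)]
  all_goals simp [h2, h3]

/-- Comparing one more pair; `D` holds the pairs compared before. -/
theorem run_scanPair {j s : ℕ} {D : ℕ → ℕ → Prop} (hE : Env n m w c τ) (hs : Same σ τ)
    (h8 : τ.nreg 8 = j) (h9 : τ.nreg 9 = s) (hj : j < n) (hsm : s < m)
    (hrk : 1 ≤ rank σ (asg σ j)) (h1 : τ.rreg 1 = c j (asg σ j) + price σ (asg σ j))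
    (hB : Best n m w c σ D τ) :
    Run scanPair 0 τ fun t τ' => t ≤ 15 ∧ Same σ τ' ∧ τ'.nreg 8 = j ∧ τ'.nreg 9 = s ∧
      τ'.rreg 1 = τ.rreg 1 ∧ Best n m w c σ (fun j' s' => D j' s' ∨ j' = j ∧ s' = s) τ' := by
  have g2 := hE.one
  have g3 := hE.zero
  have hw : τ.narr 1 j s - τ.narr 3 s 0 = w j s - rank σ s := by
    rw [hE.win, rank, hs.narr]
  have hsl : τ.rarr 0 j s + τ.rarr 1 s 0 - τ.rreg 1 = slack c (asg σ) (price σ) j s := by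
    rw [hE.costs, h1, hs.rarr]; rfl
  refine run_nload <| run_nload <| run_nsub <| run_branch (fun hb => ?_) (fun hb => ?_)
  · have hc : Candidate n m w (asg σ) (rank σ) j s := by
      refine ⟨hj, hsm, hrk, ?_⟩
      simpa [Test.Holds, g2, g3, h8, h9, hw] using hb
    -- recording the pair at hand is right if it beats the recorded one or there is none
    have key : ∀ τ₁ : Mem, Same σ τ₁ → τ₁.nreg 8 = j → τ₁.nreg 9 = s → τ₁.rreg 1 = τ.rreg 1 →
        τ₁.nreg 12 = τ.nreg 12 → τ₁.nreg 10 = τ.nreg 10 → τ₁.nreg 11 = τ.nreg 11 →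
        τ₁.rreg 0 = τ.rreg 0 →
        τ₁.rreg 2 = slack c (asg σ) (price σ) j s → (τ.nreg 12 = 1 → τ₁.rreg 2 ≤ τ.rreg 0) →
        ∀ T ≤ 10, Run (record ++ []) T τ₁ fun t τ' => t ≤ 15 ∧ Same σ τ' ∧ τ'.nreg 8 = j ∧
          τ'.nreg 9 = s ∧ τ'.rreg 1 = τ.rreg 1 ∧
          Best n m w c σ (fun j' s' => D j' s' ∨ j' = j ∧ s' = s) τ' := by
      intro τ₁ k1 k2 k3 k4 k5 k6 k7 k8 k9 k10 T hT
      have hE₁ : Env n m w c τ₁ := by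
        refine hE.same ⟨k1.narr.trans hs.narr.symm, k1.rarr.trans hs.rarr.symm, fun r hr => ?_⟩
        rw [k1.nreg r hr, hs.nreg r hr]
      refine run_record hE₁ k1 fun τ' l1 l2 l3 l4 l5 l6 l7 => run_nil ?_
      refine ⟨by omega, l1, by rw [l2 8 (by norm_num), k2], by rw [l2 9 (by norm_num), k3],
        by rw [l3, k4], .inr ⟨l4, ?_, ?_, ?_⟩⟩
      · rw [l5, l6, k2, k3]; exact hc
      · rw [l5, l6, l7, k2, k3, k9]
      · rintro j' s' (hD | ⟨rfl, rfl⟩) hc'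
        · rcases hB with ⟨_, b2⟩ | ⟨b1, _, _, b4⟩
          · exact absurd hc' (b2 j' s' hD)
          · rw [l7]; exact (k10 b1).trans (b4 j' s' hD hc')
        · rw [l7, k9]
    refine run_rload <| run_rload <| run_radd <| run_rsub <| run_branch (fun hf => ?_) (fun hf => ?_)
    · refine run_branch (fun hle => ?_) (fun hle => ?_)
      · simp only [Test.Holds, Mem.nreg_setN, Mem.nreg_setR, g2, Nat.reduceEqDiff, if_false] at hf
        simp [Test.Holds, g3, h8, h9, hsl] at hle
        refine run_nil ⟨by omega, ?_, by simp [h8], by simp [h9], by simp, ?_⟩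
        · refine Same.setR (Same.setR (Same.setR (Same.setR (Same.setN (Same.setN (Same.setN hs
            ?_ _) ?_ _) ?_ _) _ _) _ _) _ _) _ _ <;> norm_num
        · refine Best.congr (τ := τ) ?_ (by simp) (by simp) (by simp) (by simp)
          rcases hB with ⟨b1, _⟩ | ⟨b1, b2, b3, b4⟩
          · omega
          · refine .inr ⟨b1, b2, b3, ?_⟩
            rintro j' s' (hD | ⟨rfl, rfl⟩) hc'
            · exact b4 j' s' hD hc'
            · exact hle
      · simp [Test.Holds, g3, h8, h9, hsl] at hle
        refine key _ ?_ (by simp [h8]) (by simp [h9]) (by simp) (by simp) (by simp) (by simp)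
          (by simp) (by simp [g3, h8, h9, hsl]) (fun _ => ?_) _ (by omega)
        · refine Same.setR (Same.setR (Same.setR (Same.setR (Same.setN (Same.setN (Same.setN hs
            ?_ _) ?_ _) ?_ _) _ _) _ _) _ _) _ _ <;> norm_num
        · simp [g3, h8, h9, hsl, hle.le]
    · simp only [Test.Holds, Mem.nreg_setN, Mem.nreg_setR, g2, Nat.reduceEqDiff, if_false] at hf
      refine key _ ?_ (by simp [h8]) (by simp [h9]) (by simp) (by simp) (by simp) (by simp)
          (by simp) (by simp [g3, h8, h9, hsl]) (fun _ => ?_) _ (by omega)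
      · refine Same.setR (Same.setR (Same.setR (Same.setR (Same.setN (Same.setN (Same.setN hs
          ?_ _) ?_ _) ?_ _) _ _) _ _) _ _) _ _ <;> norm_num
      · omega
  · refine run_nil ⟨by omega, ?_, by simp [h8], by simp [h9], by simp, ?_⟩
    · refine Same.setN (Same.setN (Same.setN hs ?_ _) ?_ _) ?_ _ <;> norm_num
    · refine (hB.anti ?_).congr (by simp) (by simp) (by simp) (by simp)
      rintro j' s' (hD | ⟨rfl, rfl⟩) hc
      · exact hD
      · refine absurd hc.2.2.2 ?_
        simpa [Test.Holds, g2, g3, h8, h9, hw] using hb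

theorem run_scanRow {j : ℕ} {D : ℕ → ℕ → Prop} (hE : Env n m w c τ) (hs : Same σ τ)
    (h8 : τ.nreg 8 = j) (hj : j < n) (hB : Best n m w c σ D τ) :
    Run scanRow 0 τ fun t τ' => t ≤ m * 17 + 8 ∧ Same σ τ' ∧ τ'.nreg 8 = j ∧
      Best n m w c σ (fun j' s' => D j' s' ∨ j' = j) τ' := by
  have g1 := hE.slots
  have g2 := hE.one
  have g3 := hE.zero
  have ha : τ.narr 2 j 0 = asg σ j := by rw [asg, hs.narr]
  have hr : ∀ s, τ.narr 3 s 0 = rank σ s := fun s => by rw [rank, hs.narr]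
  have hp : ∀ s, τ.rarr 1 s 0 = price σ s := fun s => by rw [price, hs.rarr]
  have hEs : ∀ τ', Same σ τ' → Env n m w c τ' := fun τ' k1 => by
    refine hE.same ⟨k1.narr.trans hs.narr.symm, k1.rarr.trans hs.rarr.symm, fun r hr => ?_⟩
    rw [k1.nreg r hr, hs.nreg r hr]
  refine run_nload <| run_nload <| run_branch (fun hb => ?_) (fun hb => ?_)
  · simp [Test.Holds, g2, g3, h8, ha, hr] at hb
    refine run_rload <| run_rload <| run_radd ?_
    refine run_countdown (fun k τ' => τ'.nreg 9 = k ∧ τ'.nreg 8 = j ∧ Same σ τ' ∧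
      τ'.rreg 1 = c j (asg σ j) + price σ (asg σ j) ∧
      Best n m w c σ (fun j' s' => D j' s' ∨ j' = j ∧ k ≤ s') τ') 15 m ?_ ?_ ?_ ?_ ?_ ?_
    · simp [g1]
    · simp [g3]
    · refine ⟨by simp, by simp [h8], ?_, by simp [g3, h8, ha, hp, hE.costs], ?_⟩
      · refine Same.setN (Same.setR (Same.setR (Same.setR (Same.setN (Same.setN hs
          ?_ _) ?_ _) _ _) _ _) _ _) ?_ _ <;> norm_num
      · refine (hB.anti ?_).congr (by simp) (by simp) (by simp) (by simp)
        rintro j' s' (hD | ⟨rfl, hle⟩) hc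
        · exact hD
        · exact absurd hc.2.1 (by omega)
    · rintro k τ' ⟨k1, k2, k3, k4, k5⟩
      exact ⟨k1, (hEs _ k3).one⟩
    · rintro k τ' hk ⟨k1, k2, k3, k4, k5⟩
      have k3' : Same σ (τ'.setN 9 k) := k3.setN (by norm_num) _
      refine (run_scanPair (hEs _ k3') k3' (by simp [k2]) (by simp) hj hk hb (by simp [k4])
        (k5.congr (by simp) (by simp) (by simp) (by simp))).mono ?_
      rintro t τ'' ⟨l1, l2, l3, l4, l5, l6⟩
      refine ⟨l1, l4, l3, l2, by rw [l5]; simp [k4], l6.anti ?_⟩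
      rintro j' s' (hD | ⟨rfl, hle⟩) _
      · exact .inl (.inl hD)
      · rcases hle.eq_or_lt with rfl | hlt
        · exact .inr ⟨rfl, rfl⟩
        · exact .inl (.inr ⟨rfl, hlt⟩)
    · rintro t τ' ht ⟨k1, k2, k3, k4, k5⟩
      refine run_nil ⟨by omega, k3, k2, k5.anti ?_⟩
      rintro j' s' (hD | rfl) _
      · exact .inl hD
      · exact .inr ⟨rfl, Nat.zero_le _⟩
  · simp [Test.Holds, g2, g3, h8, ha, hr] at hb
    refine run_nil ⟨by omega, ?_, by simp [h8], ?_⟩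
    · refine Same.setN (Same.setN hs ?_ _) ?_ _ <;> norm_num
    · refine (hB.anti ?_).congr (by simp) (by simp) (by simp) (by simp)
      rintro j' s' (hD | rfl) hc
      · exact hD
      · have := hc.2.2.1
        omega

/-- The search ends with a candidate of smallest slack, provided that there is a candidate. -/
theorem run_scan (hE : Env n m w c σ)
    (h : ∀ t τ, t ≤ T + (n * (m * 17 + 10) + 3) → Same σ τ →
      Best n m w c σ (fun _ _ => True) τ → Run P t τ Q) : Run (scan ++ P) T σ Q := by
  have g3 := hE.zero
  rw [scan, List.append_assoc]
  refine run_nadd ?_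
  refine run_countdown (fun k τ => τ.nreg 8 = k ∧ Same σ τ ∧
      Best n m w c σ (fun j' _ => k ≤ j') τ) (m * 17 + 8) n ?_ ?_ ?_ ?_ ?_ ?_
  · simp [hE.flights]
  · simp [g3]
  · refine ⟨by simp, ((Same.refl σ).setN (by norm_num) _).setN (by norm_num) _,
      .inl ⟨by simp [g3], fun j s hj hc => ?_⟩⟩
    exact absurd hc.1 (by omega)
  · rintro k τ ⟨k1, k2, k3⟩
    exact ⟨k1, (hE.same k2).one⟩
  · rintro k τ hk ⟨k1, k2, k3⟩
    have k2' : Same σ (τ.setN 8 k) := k2.setN (by norm_num) _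
    refine (run_scanRow (hE.same k2') k2' (by simp) hk
      (k3.congr (by simp) (by simp) (by simp) (by simp))).mono ?_
    rintro t τ' ⟨l1, l2, l3, l4⟩
    refine ⟨l1, l3, l2, l4.anti fun j' s' hle _ => ?_⟩
    omega
  · rintro t τ ht ⟨k1, k2, k3⟩
    refine h t τ (ht.trans (le_of_eq ?_)) k2 (k3.anti fun _ _ _ _ => Nat.zero_le _)
    ring

end

/-! ### The algorithm -/

@[simp] theorem Mem.narr_setNA_of_ne (σ : Mem) {a a' : ℕ} (h : a' ≠ a) (i j v : ℕ) :
    (σ.setNA a i j v).narr a' = σ.narr a' := by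
  funext i' j'; simp [h]

@[simp] theorem Mem.rarr_setRA_of_ne (σ : Mem) {a a' : ℕ} (h : a' ≠ a) (i j : ℕ) (v : ℝ) :
    (σ.setRA a i j v).rarr a' = σ.rarr a' := by
  funext i' j'; simp [h]

/-- Raise the prices of all reached slots by real register `0`. -/
def raisePrices : Program :=
  countdown 9 7
    [.nload 13 3 9 3,
      .branch (.nle 2 13) [.rload 1 1 9 3, .radd 1 1 0, .rstore 1 9 3 1] []]

/-- Add the best candidate to the tree and make its slot the current one. -/
def addToTree : Program :=
  [.nadd 6 6 2, .nstore 3 11 3 6, .nstore 4 11 3 10, .nadd 5 11 3, .nload 13 0 5 3]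

/-- One step of growing the search tree. -/
def growTree : Program := scan ++ (raisePrices ++ addToTree)

/-- Make the virtual slot the only reached slot, of rank `1`, and the current slot (register `5`);
register `6` holds the largest rank, register `13` the residual capacity of the current slot. -/
def resetTree : Program :=
  countdown 9 1 [.nstore 3 9 3 3] ++
    [.nstore 3 1 3 2, .nadd 6 2 3, .nadd 5 1 3, .nload 13 0 5 3]

/-- Move the parent of the current slot into it, and continue with the slot that it left. -/
def shiftFlight : Program :=
  [.nload 8 4 5 3, .nload 9 2 8 3, .nstore 2 8 3 5, .nadd 5 9 3, .nadd 13 5 2]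

/-- Schedule one more flight: grow a search tree until it reaches a slot with residual capacity,
and move flights along the path from the root to this slot. -/
def phase : Program :=
  resetTree ++ [.loop (.nle 13 3) growTree, .nsub 13 13 2, .nstore 0 5 3 13, .nadd 13 5 2,
    .loop (.nle 13 1) shiftFlight]

/-- Put all flights into the virtual slot. -/
def setup : Program := [.nconst 2 1, .nadd 7 1 2] ++ countdown 8 0 [.nstore 2 8 3 1]

/-- The algorithm: as many phases as there are flights. -/
def solve : Program := setup ++ countdown 4 0 phase

/-- The number of slots without a rank. -/
def unreached (m : ℕ) (rk : ℕ → ℕ) : ℕ := ((Finset.range m).filter fun s => rk s = 0).card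

theorem unreached_update {m s b : ℕ} {rk rk' : ℕ → ℕ} (hs : s < m) (h0 : rk s = 0)
    (h : ∀ i, rk' i = if i = s then b + 1 else rk i) : unreached m rk' + 1 = unreached m rk := by
  have : (Finset.range m).filter (fun i => rk' i = 0)
      = ((Finset.range m).filter fun i => rk i = 0).erase s := by
    ext i
    by_cases hi : i = s <;> simp [h, hi]
  rw [unreached, this, unreached]
  exact Finset.card_erase_add_one (by simp [hs, h0])

/-- The assertion about the memory that holds throughout, after the initialisation. -/
structure Base (n m : ℕ) (w : ℕ → ℕ → ℕ) (c : ℕ → ℕ → ℝ) (k : ℕ) (σ : Mem) : Prop where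
  env : Env n m w c σ
  part : Partial n m w c (asg σ) (price σ) (resid σ)
  resid_virtual : resid σ m = 0
  counter : σ.nreg 4 = k

/-- The flights in a slot, its residual capacity and the given capacity are in balance, but for one
place missing in slot `hole`; the virtual slot counts as a slot of capacity `u`.  There is no hole
if `hole` is `m + 1`. -/
def Balanced (n m : ℕ) (cap : ℕ → ℕ) (u : ℕ) (x r : ℕ → ℕ) (hole : ℕ) : Prop :=
  ∀ s ≤ m, occ n x s + r s + (if s = hole then 1 else 0) = if s = m then u else cap s

/-- The invariant of the growth of the tree; `f` slots have not been reached yet. -/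
structure Growing (n m : ℕ) (w : ℕ → ℕ → ℕ) (c : ℕ → ℕ → ℝ) (cap : ℕ → ℕ) (u k f : ℕ)
    (σ : Mem) : Prop extends Base n m w c k σ where
  balanced : Balanced n m cap u (asg σ) (resid σ) (m + 1)
  tree : IsTree n m w c (asg σ) (price σ) (rank σ) (parent σ) (σ.nreg 6)
  rank_le : ∀ s ≤ m, rank σ s ≤ σ.nreg 6
  rank_root : 1 ≤ rank σ m
  cur_le : σ.nreg 5 ≤ m
  rank_cur : 1 ≤ rank σ (σ.nreg 5)
  resid_cur : σ.nreg 13 = resid σ (σ.nreg 5)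
  full : ∀ s < m, 1 ≤ rank σ s → s ≠ σ.nreg 5 → resid σ s = 0
  count : unreached m (rank σ) = f
  rank_count : σ.nreg 6 + f = m + 1

/-- The invariant of the moves along the tree; `f` is the rank of the current slot. -/
structure Moving (n m : ℕ) (w : ℕ → ℕ → ℕ) (c : ℕ → ℕ → ℝ) (cap : ℕ → ℕ) (u k f : ℕ)
    (σ : Mem) : Prop extends Base n m w c k σ where
  balanced : Balanced n m cap u (asg σ) (resid σ) (σ.nreg 5)
  tree : IsTree n m w c (asg σ) (price σ) (rank σ) (parent σ) (rank σ (σ.nreg 5))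
  cur_le : σ.nreg 5 ≤ m
  rank_cur : 1 ≤ rank σ (σ.nreg 5)
  cur_succ : σ.nreg 13 = σ.nreg 5 + 1
  fuel : rank σ (σ.nreg 5) = f

/-- The invariant of the phases: `u` flights are not yet scheduled, and the phase counter is `k`. -/
structure Phased (n m : ℕ) (w : ℕ → ℕ → ℕ) (c : ℕ → ℕ → ℝ) (cap : ℕ → ℕ) (u k : ℕ)
    (σ : Mem) : Prop extends Base n m w c k σ where
  balanced : Balanced n m cap u (asg σ) (resid σ) (m + 1)

/-- The data form a market in which `y` is a landing schedule. -/
structure Solvable (n m : ℕ) (w : ℕ → ℕ → ℕ) (cap : ℕ → ℕ) (y : ℕ → ℕ) : Prop where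
  le_one : ∀ j s, w j s ≤ 1
  window : ∀ j < n, y j < m ∧ w j (y j) = 1
  cap : ∀ s < m, occ n y s ≤ cap s

section
variable {n m : ℕ} {w : ℕ → ℕ → ℕ} {c : ℕ → ℕ → ℝ} {cap y : ℕ → ℕ} {u k f : ℕ} {σ : Mem}
  {P : Program} {T : ℕ} {Q : ℕ → Mem → Prop}

theorem run_raisePrices (hE : Env n m w c σ)
    (h : ∀ t τ, t ≤ T + ((m + 1) * 7 + 2) → τ.narr = σ.narr → τ.rarr 0 = σ.rarr 0 →
      (∀ r, r < 9 ∨ r = 10 ∨ r = 11 → τ.nreg r = σ.nreg r) →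
      (∀ s ≤ m, price τ s = price σ s + if 1 ≤ rank σ s then σ.rreg 0 else 0) → Run P t τ Q) :
    Run (raisePrices ++ P) T σ Q := by
  refine run_countdown (fun k τ => τ.nreg 9 = k ∧ τ.narr = σ.narr ∧ τ.rarr 0 = σ.rarr 0 ∧
    (∀ r, r < 9 ∨ r = 10 ∨ r = 11 → τ.nreg r = σ.nreg r) ∧ τ.rreg 0 = σ.rreg 0 ∧
    ∀ s ≤ m, price τ s = price σ s + if k ≤ s ∧ 1 ≤ rank σ s then σ.rreg 0 else 0)
    5 (m + 1) hE.succ hE.zero ?_ ?_ ?_ ?_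
  · refine ⟨by simp, by simp, by simp, fun r hr => ?_, by simp, fun s hs => ?_⟩
    · rw [Mem.nreg_setN, if_neg (by omega)]
    · rw [if_neg (by omega)]; simp [price]
  · rintro k τ ⟨k1, k2, k3, k4, k5, k6⟩
    exact ⟨k1, by rw [k4 2 (by omega), hE.one]⟩
  · rintro k τ hk ⟨k1, k2, k3, k4, k5, k6⟩
    have g2 : τ.nreg 2 = 1 := by rw [k4 2 (by omega), hE.one]
    have g3 : τ.nreg 3 = 0 := by rw [k4 3 (by omega), hE.zero]
    refine run_nload <| run_branch (fun hb => ?_) (fun hb => ?_)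
    · replace hb : 1 ≤ rank σ k := by simpa [Test.Holds, g2, g3, rank, k2] using hb
      refine run_rload <| run_radd <| run_rstore <| run_nil ⟨by omega, by simp, by simp [k2],
        by simp [k3], fun r hr => ?_, by simp [k5], fun s hs => ?_⟩
      · simp only [Mem.nreg_setN, Mem.nreg_setRA, Mem.nreg_setR]
        rw [if_neg (by omega), if_neg (by omega), k4 r hr]
      · have h1 := k6 s hs
        simp only [price] at h1 ⊢
        by_cases hsk : s = k
        · subst hsk
          simp [g3, h1, k5, hb]
        · have : k ≤ s ↔ k + 1 ≤ s := by omega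
          simp [hsk, h1, this]
    · replace hb : rank σ k = 0 := by simpa [Test.Holds, g2, g3, rank, k2] using hb
      refine run_nil ⟨by omega, by simp, by simp [k2], by simp [k3], fun r hr => ?_, by simp [k5],
        fun s hs => ?_⟩
      · simp only [Mem.nreg_setN]
        rw [if_neg (by omega), if_neg (by omega), k4 r hr]
      · have h1 := k6 s hs
        simp only [price] at h1 ⊢
        by_cases hsk : s = k
        · subst hsk
          simp [h1, hb]
        · have : k ≤ s ↔ k + 1 ≤ s := by omega
          simp [h1, this]
  · rintro t τ ht ⟨k1, k2, k3, k4, k5, k6⟩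
    refine h t τ (by omega) k2 k3 k4 fun s hs => ?_
    rw [k6 s hs]
    simp

/-- As long as the current slot is full, the tree can grow; every step reaches a new slot. -/
theorem run_growTree (hS : Solvable n m w cap y) (hu : 1 ≤ u)
    (h : Growing n m w c cap u k f σ) (hb : σ.nreg 13 = 0) :
    Run growTree 0 σ fun t τ => t ≤ n * (m * 17 + 10) + m * 7 + 17 ∧
      ∃ f' < f, Growing n m w c cap u k f' τ := by
  have hfull : ∀ s < m, 1 ≤ rank σ s → resid σ s = 0 := by
    intro s hs hr
    by_cases hc : s = σ.nreg 5
    · rw [hc, ← h.resid_cur, hb]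
    · exact h.full s hs hr hc
  obtain ⟨j₀, s₀, hcand⟩ : ∃ j s, Candidate n m w (asg σ) (rank σ) j s := by
    refine h.part.exists_candidate hS.window hS.cap (fun s hs => ?_) ?_ h.rank_root hfull
    · have := h.balanced s hs.le
      rwa [if_neg (by omega), if_neg (by omega), add_zero] at this
    · have := h.balanced m le_rfl
      rw [if_neg (by omega), if_pos rfl, add_zero, h.resid_virtual] at this
      omega
  refine run_scan h.env fun t τ ht hs hB => ?_
  rcases hB with ⟨_, b⟩ | ⟨_, b2, b3, b4⟩
  · exact absurd hcand (b j₀ s₀ trivial)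
  have hE := h.env.same hs
  refine run_raisePrices hE fun t' τ' ht' k1 k2 k3 k4 => ?_
  have g2 : τ'.nreg 2 = 1 := by rw [k3 2 (by omega), hE.one]
  have g3 : τ'.nreg 3 = 0 := by rw [k3 3 (by omega), hE.zero]
  have g6 : τ'.nreg 6 = σ.nreg 6 := by rw [k3 6 (by omega), hs.nreg 6 (by omega)]
  have g10 := k3 10 (by omega)
  have g11 := k3 11 (by omega)
  have hna : τ'.narr = σ.narr := k1.trans hs.narr
  have hpr : price τ = price σ := by funext s; rw [price, hs.rarr, price]
  have hrk : rank τ = rank σ := by funext s; rw [rank, hs.narr, rank]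
  generalize hjj : τ.nreg 10 = j at *
  generalize hss : τ.nreg 11 = s at *
  have hsne : s ≠ m := b2.2.1.ne
  refine run_nadd <| run_nstore <| run_nstore <| run_nadd <| run_nload <| run_nil ⟨by omega, ?_⟩
  set ρ := (((((τ'.setN 6 _).setNA 3 _ _ _).setNA 4 _ _ _).setN 5 _).setN 13 _) with hρ
  have r5 : ρ.nreg 5 = s := by simp [hρ, g3, g11]
  have r6 : ρ.nreg 6 = σ.nreg 6 + 1 := by simp [hρ, g2, g6]
  have ra : asg ρ = asg σ := by funext i; simp [hρ, asg, hna]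
  have rr : resid ρ = resid σ := by funext i; simp [hρ, resid, hna]
  have rp : price ρ = price τ' := rfl
  have rk' : ∀ i, rank ρ i = if i = s then σ.nreg 6 + 1 else rank σ i := by
    intro i; simp [hρ, rank, g2, g3, g6, g11, hna]
  have rpar : ∀ i, parent ρ i = if i = s then j else parent σ i := by
    intro i; simp [hρ, parent, g3, g10, g11, hna]
  have rs0 : rank σ s = 0 := by
    have := hS.le_one j s
    have := b2.2.2.2
    omega
  obtain ⟨hP, hT⟩ := h.part.grow (p' := price ρ) (rk' := rank ρ) (par' := parent ρ) hS.le_one h.tree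
    h.rank_le hfull b2 (fun j' s' hc => by rw [← b3]; exact b4 j' s' trivial hc)
    (fun i hi => by rw [rp, k4 i hi, hpr, hrk, b3]) rk' rpar
  have hcard := unreached_update b2.2.1 rs0 rk'
  have hcount := h.count
  have hrc := h.rank_count
  refine ⟨f - 1, by omega, ⟨⟨?_, by rwa [ra, rr], by rw [rr]; exact h.resid_virtual, ?_⟩,
    by rw [ra, rr]; exact h.balanced, by rwa [ra, r6], ?_, ?_, ?_, ?_, ?_, ?_, by omega, by omega⟩⟩
  · have e : ∀ r < 8, τ'.nreg r = σ.nreg r := fun r hr => by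
      rw [k3 r (by omega), hs.nreg r hr]
    obtain ⟨e0, e1, e2, e3, e4, e5, e6⟩ := h.env
    constructor
    · simp [hρ, e, e0]
    · simp [hρ, e, e1]
    · simp [hρ, e, e2]
    · simp [hρ, e, e3]
    · simp [hρ, e, e4]
    · simp [hρ, hna, e5]
    · simp [hρ, k2, hs.rarr, e6]
  · have : τ'.nreg 4 = σ.nreg 4 := by rw [k3 4 (by omega), hs.nreg 4 (by omega)]
    simp [hρ, this, h.counter]
  · intro i hi
    have := h.rank_le i hi
    rw [rk', r6]
    split_ifs <;> omega
  · rw [rk', if_neg hsne.symm]; exact h.rank_root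
  · rw [r5]; exact b2.2.1.le
  · rw [r5, rk', if_pos rfl]; omega
  · rw [r5, rr]; simp [hρ, g3, g11, resid, hna]
  · intro i hi hri hne
    rw [r5] at hne
    rw [rk', if_neg hne] at hri
    rw [rr]
    exact hfull i hi hri

theorem run_resetTree (h : Phased n m w c cap u k σ)
    (hQ : ∀ t τ, t ≤ T + (m * 3 + 6) → Growing n m w c cap u k m τ → Run P t τ Q) :
    Run (resetTree ++ P) T σ Q := by
  obtain ⟨e0, e1, e2, e3, e4, e5, e6⟩ := h.env
  rw [resetTree, List.append_assoc]
  refine run_countdown (fun k τ => τ.nreg 9 = k ∧ (∀ a ≠ 3, τ.narr a = σ.narr a) ∧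
    τ.rarr = σ.rarr ∧ (∀ r < 8, τ.nreg r = σ.nreg r) ∧
    ∀ s < m, k ≤ s → rank τ s = 0) 1 m e1 e3 ?_ ?_ ?_ ?_
  · refine ⟨by simp, by simp, by simp, fun r hr => ?_, fun s hs hs' => by omega⟩
    rw [Mem.nreg_setN, if_neg (by omega)]
  · rintro k τ ⟨k1, k2, k3, k4, k5⟩
    exact ⟨k1, by rw [k4 2 (by omega), e2]⟩
  · rintro k τ hk ⟨k1, k2, k3, k4, k5⟩
    have g3 : τ.nreg 3 = 0 := by rw [k4 3 (by omega), e3]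
    refine run_nstore <| run_nil ⟨by omega, by simp, fun a ha => ?_, by simp [k3],
      fun r hr => ?_, fun s hs hks => ?_⟩
    · simp [ha, k2]
    · simp only [Mem.nreg_setN, Mem.nreg_setNA]
      rw [if_neg (by omega), k4 r hr]
    · by_cases hsk : s = k
      · simp [rank, g3, hsk]
      · have := k5 s hs (by omega)
        simp only [rank] at this ⊢
        simp [hsk, this]
  · rintro t τ ht ⟨k1, k2, k3, k4, k5⟩
    have g1 : τ.nreg 1 = m := by rw [k4 1 (by omega), e1]
    have g2 : τ.nreg 2 = 1 := by rw [k4 2 (by omega), e2]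
    have g3 : τ.nreg 3 = 0 := by rw [k4 3 (by omega), e3]
    refine run_nstore <| run_nadd <| run_nadd <| run_nload <| hQ _ _ (by omega) ?_
    set ρ := ((((τ.setNA 3 _ _ _).setN 6 _).setN 5 _).setN 13 _) with hρ
    have r5 : ρ.nreg 5 = m := by simp [hρ, g3, g1]
    have r6 : ρ.nreg 6 = 1 := by simp [hρ, g2, g3]
    have ra : asg ρ = asg σ := by funext i; simp [hρ, asg, k2]
    have rr : resid ρ = resid σ := by funext i; simp [hρ, resid, k2]
    have rp : price ρ = price σ := by funext i; simp [hρ, price, k3]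
    have rkm : rank ρ m = 1 := by simp [hρ, rank, g1, g2, g3]
    have rk0 : ∀ s < m, rank ρ s = 0 := by
      intro s hs
      have := k5 s hs (Nat.zero_le _)
      simp only [rank] at this
      simp [hρ, rank, g1, hs.ne, this]
    refine ⟨⟨?_, by rw [ra, rp, rr]; exact h.part, by rw [rr]; exact h.resid_virtual, ?_⟩,
      by rw [ra, rr]; exact h.balanced, ?_, ?_, by rw [rkm], by rw [r5],
      by rw [r5, rkm], ?_, ?_, ?_, by rw [r6, add_comm]⟩
    · constructor
      · simp [hρ, k4, e0]
      · simp [hρ, k4, e1]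
      · simp [hρ, k4, e2]
      · simp [hρ, k4, e3]
      · simp [hρ, k4, e4]
      · simp [hρ, k2, e5]
      · simp [hρ, k3, e6]
    · simp [hρ, k4, h.counter]
    · intro s hs hs1
      rw [rk0 s hs] at hs1
      omega
    · intro s hs
      rcases hs.lt_or_eq with hs | rfl
      · rw [rk0 s hs]; omega
      · rw [rkm, r6]
    · rw [r5]; simp [hρ, resid, g1, g2, g3]
    · intro s hs hs1
      rw [rk0 s hs] at hs1
      omega
    · rw [unreached, Finset.filter_true_of_mem, Finset.card_range]
      exact fun s hs => rk0 s (Finset.mem_range.1 hs)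

/-- The hole moves from the current slot to the slot that its parent flight leaves, which has smaller
rank. -/
theorem run_shiftFlight (h : Moving n m w c cap u k f σ) (hb : σ.nreg 5 < m) :
    Run shiftFlight 0 σ fun t τ => t ≤ 5 ∧ ∃ f' < f, Moving n m w c cap u k f' τ := by
  obtain ⟨e0, e1, e2, e3, e4, e5, e6⟩ := h.env
  obtain ⟨t1, t2, t3, t4, t5⟩ := h.tree _ hb h.rank_cur le_rfl
  have hf := h.fuel
  refine run_nload <| run_nload <| run_nstore <| run_nadd <| run_nadd <| run_nil ⟨by omega, ?_⟩
  set ρ := (((((σ.setN 8 _).setN 9 _).setNA 2 _ _ _).setN 5 _).setN 13 _) with hρ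
  have r5 : ρ.nreg 5 = asg σ (parent σ (σ.nreg 5)) := by simp [hρ, e3, asg, parent]
  have r13 : ρ.nreg 13 = asg σ (parent σ (σ.nreg 5)) + 1 := by simp [hρ, e2, e3, asg, parent]
  have ra : ∀ i, asg ρ i = if i = parent σ (σ.nreg 5) then σ.nreg 5 else asg σ i := by
    intro i
    by_cases hi : i = σ.narr 4 (σ.nreg 5) 0 <;> simp [hρ, asg, parent, e3, hi]
  have rr : resid ρ = resid σ := by funext i; simp [hρ, resid]
  have rp : price ρ = price σ := by funext i; simp [hρ, price]
  have rk : rank ρ = rank σ := by funext i; simp [hρ, rank]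
  have rpar : parent ρ = parent σ := by funext i; simp [hρ, parent]
  obtain ⟨hP, hT⟩ := h.part.move h.tree hb h.rank_cur ra
  refine ⟨_, ?_, ⟨⟨?_, by rwa [rp, rr], by rw [rr]; exact h.resid_virtual, ?_⟩, ?_,
    by rwa [r5, rp, rk, rpar], by rw [r5]; exact h.part.le _ t1, by rwa [r5, rk],
    by rw [r13, r5], rfl⟩⟩
  · rw [r5, rk]; omega
  · constructor
    · simp [hρ, e0]
    · simp [hρ, e1]
    · simp [hρ, e2]
    · simp [hρ, e3]
    · simp [hρ, e4]
    · simp [hρ, e5]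
    · simp [hρ, e6]
  · simp [hρ, h.counter]
  · intro s hs
    have h1 := h.balanced s hs
    have h2 := occ_update t1 ra s
    rw [r5, rr]
    omega

/-- A bound on the time of a phase. -/
def phaseTime (n m : ℕ) : ℕ := m * (n * (m * 17 + 10) + m * 7 + 18) + 9 * m + 20

/-- A phase takes one flight out of the virtual slot. -/
theorem run_phase (hS : Solvable n m w cap y) (hu : 1 ≤ u) {σ₀ : Mem}
    (h : Phased n m w c cap u k σ₀) : Run phase 0 σ₀ fun t τ => t ≤ phaseTime n m ∧ Phased n m w c cap (u - 1) k τ := by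
  refine run_resetTree h fun t τ ht hG => ?_
  refine run_loop (Growing n m w c cap u k) (n * (m * 17 + 10) + m * 7 + 17) m hG ?_ ?_
  · intro f τ' hG' hb
    have h3 := hG'.env.zero
    simp only [Test.Holds, h3, Nat.le_zero] at hb
    exact run_growTree hS hu hG' hb
  clear hG
  intro t' σ f ht' hG hb
  obtain ⟨e0, e1, e2, e3, e4, e5, e6⟩ := hG.env
  simp only [Test.Holds, e3, Nat.le_zero] at hb
  have hres := hG.resid_cur
  -- The virtual slot has residual capacity `0`, so that the search does not stop there.
  have hcm : σ.nreg 5 < m := by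
    refine lt_of_le_of_ne hG.cur_le fun he => ?_
    rw [he, hG.resid_virtual] at hres
    omega
  refine run_nsub <| run_nstore <| run_nadd ?_
  set ρ := (((σ.setN 13 _).setNA 0 _ _ _).setN 13 _) with hρ
  have r5 : ρ.nreg 5 = σ.nreg 5 := by simp [hρ]
  have ra : asg ρ = asg σ := by funext i; simp [hρ, asg]
  have rr : ∀ i, resid ρ i = if i = σ.nreg 5 then resid σ i - 1 else resid σ i := by
    intro i
    simp only [resid] at hres
    by_cases hi : i = σ.nreg 5 <;> simp [hρ, resid, e2, e3, hi, hres]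
  have rp : price ρ = price σ := by funext i; simp [hρ, price]
  have rk : rank ρ = rank σ := by funext i; simp [hρ, rank]
  have rpar : parent ρ = parent σ := by funext i; simp [hρ, parent]
  have hM : Moving n m w c cap u k (rank σ (σ.nreg 5)) ρ := by
    refine ⟨⟨?_, ?_, ?_, by simp [hρ, hG.counter]⟩, ?_, ?_, by rw [r5]; exact hG.cur_le,
      by rw [r5, rk]; exact hG.rank_cur, by simp [hρ, e2], by rw [r5, rk]⟩
    · constructor
      · simp [hρ, e0]
      · simp [hρ, e1]
      · simp [hρ, e2]
      · simp [hρ, e3]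
      · simp [hρ, e4]
      · simp [hρ, e5]
      · simp [hρ, e6]
    · rw [ra, rp]
      refine ⟨hG.part.le, hG.part.window, hG.part.nonneg, fun s hs hrs => ?_, hG.part.min_cost⟩
      refine hG.part.price_zero s hs ?_
      rw [rr] at hrs
      split_ifs at hrs <;> omega
    · rw [rr, if_neg (by omega)]; exact hG.resid_virtual
    · intro s hs
      have := hG.balanced s hs
      rw [if_neg (show s ≠ m + 1 by omega)] at this
      rw [ra, rr, r5]
      by_cases hsc : s = σ.nreg 5
      · rw [if_pos hsc, if_pos hsc]
        rw [← hsc] at hres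
        omega
      · rw [if_neg hsc, if_neg hsc]
        exact this
    · rw [r5, ra, rp, rk, rpar]
      exact fun s hs h1 h2 => hG.tree s hs h1 (h2.trans (hG.rank_le _ hcm.le))
  clear_value ρ
  refine run_loop (Moving n m w c cap u k) 5 (rank σ (σ.nreg 5)) hM ?_ ?_
  · intro f τ' hM' hb
    have h1 := hM'.env.slots
    have h13 := hM'.cur_succ
    simp only [Test.Holds, h1, h13] at hb
    exact run_shiftFlight hM' (by omega)
  · intro t'' τ' f' ht'' hM' hb'
    have h1 := hM'.env.slots
    have h13 := hM'.cur_succ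
    simp only [Test.Holds, h1, h13] at hb'
    have hcur : τ'.nreg 5 = m := by have := hM'.cur_le; omega
    refine run_nil ⟨?_, hM'.toBase, fun s hs => ?_⟩
    · have h6 := hG.rank_le _ hcm.le
      have h7 := hG.rank_count
      simp only [phaseTime]
      have e : m * (n * (m * 17 + 10) + m * 7 + 17 + 1) = m * (n * (m * 17 + 10) + m * 7 + 18) := rfl
      omega
    · have := hM'.balanced s hs
      rw [hcur] at this
      rw [if_neg (show s ≠ m + 1 by omega)]
      by_cases hsm : s = m
      · simp only [hsm, if_true] at this ⊢
        omega
      · simp only [hsm, if_false] at this ⊢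
        omega

/-- A bound on the time of the algorithm. -/
def solveTime (n m : ℕ) : ℕ := n * (phaseTime n m + 5) + 6

/-- The algorithm, on the data of a market with a landing schedule, ends with an equilibrium. -/
theorem run_solve (hS : Solvable n m w cap y) (hc : ∀ j s, 0 ≤ c j s) (hcm : ∀ j, c j m = 0)
    (h0 : σ.nreg 0 = n) (h1 : σ.nreg 1 = m) (h3 : σ.nreg 3 = 0) (hw : σ.narr 1 = w)
    (hca : σ.rarr 0 = c) (hcap : ∀ s < m, resid σ s = cap s) (hcapm : resid σ m = 0)
    (hp : ∀ s, price σ s = 0) :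
    Run solve 0 σ fun t τ => t ≤ solveTime n m ∧ Phased n m w c cap 0 0 τ := by
  rw [solve, setup, List.append_assoc]
  refine run_nconst <| run_nadd ?_
  refine run_countdown (fun k τ => τ.nreg 8 = k ∧ (∀ a ≠ 2, τ.narr a = σ.narr a) ∧
    τ.rarr = σ.rarr ∧ Env n m w c τ ∧
    ∀ j < n, k ≤ j → asg τ j = m) 1 n (by simp [h0]) (by simp [h3]) ?_ ?_ ?_ ?_
  · refine ⟨by simp, by simp, by simp, ?_, fun s hs hs' => by omega⟩
    constructor <;> simp [h0, h1, h3, hw, hca]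
  · rintro k τ ⟨k1, k2, k3, k4, k5⟩
    exact ⟨k1, k4.one⟩
  · rintro k τ hk ⟨k1, k2, k3, k4, k5⟩
    obtain ⟨e0, e1, e2, e3, e4, e5, e6⟩ := k4
    refine run_nstore <| run_nil ⟨by omega, by simp, fun a ha => by simp [ha, k2], by simp [k3], ?_,
      fun s hs hks => ?_⟩
    · constructor <;> simp [*]
    · by_cases hsk : s = k
      · simp [asg, e1, e3, hsk]
      · have := k5 s hs (by omega)
        simp only [asg] at this ⊢
        simp [hsk, this]
  · rintro t τ ht ⟨k1, k2, k3, k4, k5⟩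
    rw [← List.append_nil (countdown 4 0 phase)]
    have ha : ∀ j < n, asg τ j = m := fun j hj => k5 j hj (Nat.zero_le _)
    have hr : resid τ = resid σ := by funext s; simp [resid, k2]
    have hpr : ∀ s, price τ s = 0 := fun s => by rw [← hp s, price, price, k3]
    have hocc : ∀ s ≤ m, occ n (asg τ) s = if s = m then n else 0 := by
      intro s hs
      split_ifs with hsm
      · rw [occ, Finset.filter_true_of_mem, Finset.card_range]
        exact fun j hj => by rw [ha j (Finset.mem_range.1 hj), hsm]
      · rw [occ, Finset.card_eq_zero, Finset.filter_eq_empty_iff]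
        intro j hj
        rw [ha j (Finset.mem_range.1 hj)]
        exact fun h => hsm h.symm
    refine run_countdown (fun k τ => Phased n m w c cap k k τ) (phaseTime n m) n k4.flights k4.zero
      ?_ ?_ ?_ ?_
    · obtain ⟨e0, e1, e2, e3, e4, e5, e6⟩ := k4
      refine ⟨⟨by constructor <;> simp [*], ⟨fun j hj => (ha j hj).le, fun j hj hlt => ?_,
        fun s _ => (hpr s).ge, fun s _ _ => hpr s, fun j hj s hs _ => ?_⟩, ?_, by simp⟩, ?_⟩
      · exact absurd hlt (ha j hj).not_lt
      · change c j (asg τ j) + price τ (asg τ j) ≤ c j s + price τ s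
        rw [ha j hj, hcm, hpr, hpr]
        simpa using hc j s
      · change resid τ m = 0
        rw [hr, hcapm]
      · intro s hs
        change occ n (asg τ) s + resid τ s + _ = _
        rw [hocc s hs, hr, if_neg (show s ≠ m + 1 by omega)]
        by_cases hsm : s = m
        · simp [hsm, hcapm]
        · simp [hsm, hcap s (by omega)]
    · rintro k τ h
      exact ⟨h.counter, h.env.one⟩
    · rintro k τ hk h
      refine (run_phase (k := k) hS (Nat.le_add_left 1 k) ?_).mono fun t τ' h => h
      obtain ⟨⟨⟨e0, e1, e2, e3, e4, e5, e6⟩, h2, h3, h4⟩, h5⟩ := h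
      exact ⟨⟨by constructor <;> simp [*], h2, h3, by simp⟩, h5⟩
    · rintro t' τ' ht' h
      refine run_nil ⟨?_, h⟩
      simp only [solveTime]
      have e1 : n * (phaseTime n m + 5) = n * (phaseTime n m + 2) + n * 3 := by ring
      have e2 : n * (1 + 2) = n * 3 := rfl
      omega

end

/-! ### The size of the numbers in a computation -/

mutual
/-- The largest constant in a statement. -/
def Stmt.maxConst : Stmt → ℕ
  | .nconst _ k => k
  | .branch _ P Q => max (maxConst P) (maxConst Q)
  | .loop _ P => maxConst P
  | _ => 0
/-- The largest constant in a program. -/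
def maxConst : List Stmt → ℕ
  | [] => 0
  | s :: P => max s.maxConst (maxConst P)
end

theorem maxConst_append (P Q : Program) : maxConst (P ++ Q) = max (maxConst P) (maxConst Q) := by
  induction P with
  | nil => simp [maxConst]
  | cons s P ih => simp [maxConst, ih, max_assoc]

theorem maxConst_step {C : ℕ} {P : Program} (h : maxConst P ≤ C) (σ : Mem) :
    maxConst (step (P, σ)).1 ≤ C := by
  match P with
  | [] => exact h
  | .branch b R R' :: K =>
    simp only [maxConst, Stmt.maxConst, max_le_iff] at h
    simp only [step]
    split_ifs <;> simp only [maxConst_append, max_le_iff] <;> tauto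
  | .loop b R :: K =>
    simp only [maxConst, Stmt.maxConst, max_le_iff] at h
    simp only [step]
    split_ifs
    · simp only [maxConst_append, maxConst, Stmt.maxConst, max_le_iff]; tauto
    · exact h.2
  | .nconst .. :: K | .nadd .. :: K | .nsub .. :: K | .nload .. :: K | .nstore .. :: K
  | .rzero .. :: K | .radd .. :: K | .rsub .. :: K | .rload .. :: K | .rstore .. :: K =>
    exact (le_max_right _ (maxConst K)).trans h

/-- The number `v` is a fraction with denominator `D` and a numerator of at most `b` bits. -/
def IsFrac (D b : ℕ) (v : ℝ) : Prop := ∃ z : ℤ, v * D = z ∧ |z| < 2 ^ b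

theorem IsFrac.mono {D b b' : ℕ} {v : ℝ} (h : IsFrac D b v) (hb : b ≤ b') : IsFrac D b' v := by
  obtain ⟨z, h1, h2⟩ := h
  exact ⟨z, h1, h2.trans_le (pow_le_pow_right₀ (by norm_num) hb)⟩

theorem IsFrac.zero (D b : ℕ) : IsFrac D b 0 := ⟨0, by simp, by simp⟩

theorem IsFrac.add {D b : ℕ} {v v' : ℝ} (h : IsFrac D b v) (h' : IsFrac D b v') :
    IsFrac D (b + 1) (v + v') := by
  obtain ⟨z, h1, h2⟩ := h
  obtain ⟨z', h1', h2'⟩ := h'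
  refine ⟨z + z', by push_cast; rw [add_mul, h1, h1'], ?_⟩
  have := abs_add_le z z'
  rw [pow_succ]
  omega

theorem IsFrac.sub {D b : ℕ} {v v' : ℝ} (h : IsFrac D b v) (h' : IsFrac D b v') :
    IsFrac D (b + 1) (v - v') := by
  obtain ⟨z, h1, h2⟩ := h
  obtain ⟨z', h1', h2'⟩ := h'
  refine ⟨z - z', by push_cast; rw [sub_mul, h1, h1'], ?_⟩
  have := abs_sub z z'
  rw [pow_succ]
  omega

theorem IsFrac.exists_rat {D b b' : ℕ} {v : ℝ} (hD : 0 < D) (hb' : D < 2 ^ b')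
    (h : IsFrac D b v) : ∃ r : ℚ, v = r ∧ ratSize r ≤ b + b' + 1 := by
  obtain ⟨z, h1, h2⟩ := h
  refine ⟨(z : ℚ) / (D : ℤ), ?_, ?_⟩
  · push_cast
    rw [← h1, mul_div_cancel_right₀]
    exact_mod_cast hD.ne'
  · have e1 : ((z : ℚ) / (D : ℤ)).den ≤ D :=
      Nat.le_of_dvd hD (by exact_mod_cast Rat.den_dvd z D)
    have e2 : ((z : ℚ) / (D : ℤ)).num.natAbs ≤ z.natAbs := by
      by_cases hz : z = 0
      · simp [hz]
      · exact Int.natAbs_le_of_dvd_ne_zero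
          (by rw [← Rat.divInt_eq_div]; exact Rat.num_dvd z (by exact_mod_cast hD.ne')) hz
    have e3 : z.natAbs < 2 ^ b := by zify; exact h2
    have e4 := Nat.size_le.2 (e1.trans_lt hb')
    have e5 := Nat.size_le.2 (e2.trans_lt e3)
    rw [ratSize]
    omega

/-- All numbers in the memory have at most `b` bits; the real ones are fractions with common
denominator `D`. -/
structure Mem.Bounded (D b : ℕ) (σ : Mem) : Prop where
  nreg : ∀ x, σ.nreg x < 2 ^ b
  narr : ∀ a i j, σ.narr a i j < 2 ^ b
  rreg : ∀ x, IsFrac D b (σ.rreg x)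
  rarr : ∀ a i j, IsFrac D b (σ.rarr a i j)

theorem Mem.Bounded.mono {D b b' : ℕ} {σ : Mem} (h : σ.Bounded D b) (hb : b ≤ b') :
    σ.Bounded D b' :=
  have hp : 2 ^ b ≤ 2 ^ b' := Nat.pow_le_pow_right (by norm_num) hb
  ⟨fun x => (h.nreg x).trans_le hp, fun a i j => (h.narr a i j).trans_le hp,
    fun x => (h.rreg x).mono hb, fun a i j => (h.rarr a i j).mono hb⟩

section
variable {D b : ℕ} {σ : Mem}

theorem Mem.Bounded.setN (h : σ.Bounded D b) (x : ℕ) {v : ℕ} (hv : v < 2 ^ b) :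
    (σ.setN x v).Bounded D b := by
  refine ⟨fun y => ?_, h.narr, h.rreg, h.rarr⟩
  rw [Mem.nreg_setN]
  split_ifs
  exacts [hv, h.nreg y]

theorem Mem.Bounded.setR (h : σ.Bounded D b) (x : ℕ) {v : ℝ} (hv : IsFrac D b v) :
    (σ.setR x v).Bounded D b := by
  refine ⟨h.nreg, h.narr, fun y => ?_, h.rarr⟩
  rw [Mem.rreg_setR]
  split_ifs
  exacts [hv, h.rreg y]

theorem Mem.Bounded.setNA (h : σ.Bounded D b) (a i j : ℕ) {v : ℕ} (hv : v < 2 ^ b) :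
    (σ.setNA a i j v).Bounded D b := by
  refine ⟨h.nreg, fun a' i' j' => ?_, h.rreg, h.rarr⟩
  rw [Mem.narr_setNA]
  split_ifs
  exacts [hv, h.narr a' i' j']

theorem Mem.Bounded.setRA (h : σ.Bounded D b) (a i j : ℕ) {v : ℝ} (hv : IsFrac D b v) :
    (σ.setRA a i j v).Bounded D b := by
  refine ⟨h.nreg, h.narr, h.rreg, fun a' i' j' => ?_⟩
  rw [Mem.rarr_setRA]
  split_ifs
  exacts [hv, h.rarr a' i' j']

/-- One step of the machine adds at most one bit. -/
theorem Mem.Bounded.step (h : σ.Bounded D b) {P : Program} (hP : maxConst P < 2 ^ b) :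
    (step (P, σ)).2.Bounded D (b + 1) := by
  have h' : σ.Bounded D (b + 1) := h.mono (Nat.le_succ b)
  have hpow : 2 ^ (b + 1) = 2 * 2 ^ b := by ring
  match P with
  | [] => exact h'
  | .branch .. :: K => exact h'
  | .loop .. :: K => exact h'
  | .nconst x k :: K =>
    simp only [maxConst, Stmt.maxConst, max_lt_iff] at hP
    exact h'.setN x (by omega)
  | .nadd x y z :: K =>
    have := h.nreg y
    have := h.nreg z
    exact h'.setN x (by omega)
  | .nsub x y z :: K =>
    have := h.nreg y
    exact h'.setN x (by omega)
  | .nload x a i j :: K => exact h'.setN x (h'.narr _ _ _)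
  | .nstore a i j x :: K => exact h'.setNA _ _ _ (h'.nreg _)
  | .rzero x :: K => exact h'.setR x (IsFrac.zero _ _)
  | .radd x y z :: K => exact h'.setR x ((h.rreg y).add (h.rreg z))
  | .rsub x y z :: K => exact h'.setR x ((h.rreg y).sub (h.rreg z))
  | .rload x a i j :: K => exact h'.setR x (h'.rarr _ _ _)
  | .rstore a i j x :: K => exact h'.setRA _ _ _ (h'.rreg _)

theorem Mem.Bounded.iterate (h : σ.Bounded D b) {P : Program} (hP : maxConst P < 2 ^ b) (t : ℕ) :
    (Landing.step^[t] (P, σ)).2.Bounded D (b + t) ∧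
      maxConst (Landing.step^[t] (P, σ)).1 ≤ maxConst P := by
  induction t with
  | zero => exact ⟨h, le_rfl⟩
  | succ t ih =>
    rw [Function.iterate_succ_apply']
    refine ⟨ih.1.step ?_, maxConst_step ih.2 _⟩
    exact (ih.2.trans_lt hP).trans_le (Nat.pow_le_pow_right (by norm_num) (Nat.le_add_right _ _))

end

/-- The product of all denominators of the delay costs, a common denominator of all real numbers
that can occur. -/
def Market.commonDen {n m : ℕ} (M : Market (Fin n) (Fin m)) (d : Fin n → Fin m → ℚ) : ℕ :=
  ∏ i, ∏ s ∈ M.window i, (d i s).den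

section
variable {n m : ℕ} (M : Market (Fin n) (Fin m)) (d : Fin n → Fin m → ℚ)

theorem Market.commonDen_pos : 0 < M.commonDen d :=
  Finset.prod_pos fun i _ => Finset.prod_pos fun s _ => (d i s).den_pos

theorem Market.commonDen_le : M.commonDen d ≤ 2 ^ M.size d := by
  have h : M.commonDen d ≤ ∏ i, ∏ s ∈ M.window i, 2 ^ ratSize (d i s) := by
    refine Finset.prod_le_prod' fun i _ => Finset.prod_le_prod' fun s _ => ?_
    refine (Nat.lt_size_self _).le.trans (Nat.pow_le_pow_right (by norm_num) ?_)
    rw [ratSize]; omega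
  simp only [Finset.prod_pow_eq_pow_sum] at h
  refine h.trans (Nat.pow_le_pow_right (by norm_num) ?_)
  rw [Market.size]; omega

theorem Market.ratSize_le {i : Fin n} {s : Fin m} (hs : s ∈ M.window i) :
    ratSize (d i s) ≤ M.size d := by
  have h1 : ratSize (d i s) ≤ ∑ s ∈ M.window i, ratSize (d i s) :=
    Finset.single_le_sum (f := fun s => ratSize (d i s)) (fun _ _ => Nat.zero_le _) hs
  have h2 : ∑ s ∈ M.window i, ratSize (d i s) ≤ ∑ i, ∑ s ∈ M.window i, ratSize (d i s) :=
    Finset.single_le_sum (f := fun i => ∑ s ∈ M.window i, ratSize (d i s))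
      (fun _ _ => Nat.zero_le _) (Finset.mem_univ i)
  rw [Market.size]; omega

theorem Market.input_bounded (hd : ∀ i, ∀ s ∈ M.window i, M.cost i s = d i s) :
    M.input.Bounded (M.commonDen d) (2 * M.size d + 1) := by
  have hS : 2 ^ M.size d ≤ 2 ^ (2 * M.size d + 1) := Nat.pow_le_pow_right (by norm_num) (by omega)
  have h1 : 1 < 2 ^ (2 * M.size d + 1) := Nat.one_lt_two_pow (by omega)
  have hlt : ∀ k ≤ M.size d, k < 2 ^ (2 * M.size d + 1) := fun k hk =>
    (hk.trans_lt Nat.lt_two_pow_self).trans_le hS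
  refine ⟨fun x => ?_, fun a i j => ?_, fun x => IsFrac.zero _ _, fun a i j => ?_⟩
  · simp only [Market.input]
    split_ifs
    · exact hlt n (by rw [Market.size]; omega)
    · exact hlt m (by rw [Market.size]; omega)
    · omega
  · simp only [Market.input]
    split_ifs with _ h
    · refine (Nat.lt_size_self _).trans_le ((Nat.pow_le_pow_right (by norm_num) ?_).trans hS)
      have : Nat.size (M.cap ⟨i, h.1⟩) ≤ ∑ s, Nat.size (M.cap s) :=
        Finset.single_le_sum (f := fun s => Nat.size (M.cap s)) (fun _ _ => Nat.zero_le _)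
          (Finset.mem_univ _)
      rw [Market.size]; omega
    all_goals omega
  · simp only [Market.input]
    split_ifs with _ h hw
    · rw [hd _ _ hw]
      set i' : Fin n := ⟨i, h.1⟩
      set s' : Fin m := ⟨j, h.2⟩
      obtain ⟨e, he⟩ : (d i' s').den ∣ M.commonDen d :=
        (Finset.dvd_prod_of_mem (fun s => (d i' s).den) hw).trans
          (Finset.dvd_prod_of_mem (fun i => ∏ s ∈ M.window i, (d i s).den) (Finset.mem_univ i'))
      refine ⟨(d i' s').num * e, ?_, ?_⟩
      · have : ((d i' s' : ℚ) : ℝ) * ((d i' s').den : ℝ) = (d i' s').num := by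
          exact_mod_cast Rat.mul_den_eq_num (d i' s')
        rw [he]; push_cast
        rw [← mul_assoc, this]
      · have e1 : e ≤ 2 ^ M.size d := by
          refine le_trans ?_ (M.commonDen_le d)
          rw [he]
          exact Nat.le_mul_of_pos_left _ (d i' s').den_pos
        have e2 : (d i' s').num.natAbs < 2 ^ M.size d := by
          refine (Nat.lt_size_self _).trans_le (Nat.pow_le_pow_right (by norm_num) ?_)
          have := M.ratSize_le d hw
          rw [ratSize] at this
          omega
        have e3 : (d i' s').num.natAbs * e < 2 ^ (2 * M.size d + 1) := by
          calc _ ≤ (d i' s').num.natAbs * 2 ^ M.size d := Nat.mul_le_mul_left _ e1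
            _ < 2 ^ M.size d * 2 ^ M.size d :=
              Nat.mul_lt_mul_of_pos_right e2 (by positivity)
            _ = 2 ^ (2 * M.size d) := by rw [← pow_add, two_mul]
            _ ≤ _ := Nat.pow_le_pow_right (by norm_num) (by omega)
        rw [abs_mul, Nat.abs_cast, Int.abs_eq_natAbs]
        exact_mod_cast e3
    all_goals exact IsFrac.zero _ _

end

theorem eval_le_eval (T : Polynomial ℕ) {a b : ℕ} (h : a ≤ b) : T.eval a ≤ T.eval b := by
  simp only [Polynomial.eval_eq_sum, Polynomial.sum]
  exact Finset.sum_le_sum fun i _ => Nat.mul_le_mul_left _ (Nat.pow_le_pow_left h i)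

/-- A machine that has halted stays as it is. -/
theorem iterate_of_haltsWith {P : Program} {σ τ : Mem} {t t' : ℕ} (h : HaltsWith P σ t τ)
    (ht : t ≤ t') : step^[t'] (P, σ) = ([], τ) := by
  obtain ⟨k, rfl⟩ := Nat.exists_eq_add_of_le ht
  rw [add_comm, Function.iterate_add_apply, h]
  exact Function.iterate_fixed rfl k

/-- A polynomial bound on the number of steps is enough: as the machine only adds and subtracts, it
cannot produce long numbers in few steps. -/
theorem stronglyPolynomial_of_time {P : Program} (T : Polynomial ℕ)
    (hT : ∀ (n m : ℕ) (M : Market (Fin n) (Fin m)), M.Feasible →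
      ∃ τ, HaltsWith P M.input (T.eval (n + m)) τ) : StronglyPolynomial P := by
  refine ⟨⟨T, hT⟩, T + 3 * Polynomial.X + Polynomial.C (maxConst P + 3), ?_⟩
  intro n m M d hM hd t
  obtain ⟨τ, hτ⟩ := hT n m M hM
  set S := M.size d with hS
  have hTS : T.eval (n + m) ≤ T.eval S := eval_le_eval T (by rw [hS, Market.size]; omega)
  obtain ⟨t', ht', he⟩ : ∃ t' ≤ T.eval (n + m), step^[t] (P, M.input) = step^[t'] (P, M.input) := by
    rcases le_total t (T.eval (n + m)) with h | h
    · exact ⟨t, h, rfl⟩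
    · exact ⟨_, le_rfl, by rw [iterate_of_haltsWith hτ h, hτ]⟩
  have hC : maxConst P < 2 ^ (2 * S + 1 + maxConst P) :=
    Nat.lt_two_pow_self.trans_le (Nat.pow_le_pow_right (by norm_num) (Nat.le_add_left _ _))
  have hB := (((M.input_bounded d hd).mono (Nat.le_add_right _ (maxConst P))).iterate hC t').1
  rw [← he] at hB
  have hD : M.commonDen d < 2 ^ (S + 1) := by
    refine (M.commonDen_le d).trans_lt (Nat.pow_lt_pow_right (by norm_num) (Nat.lt_succ_self _))
  have heval : (T + 3 * Polynomial.X + Polynomial.C (maxConst P + 3)).eval S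
      = T.eval S + 3 * S + (maxConst P + 3) := by simp
  rw [heval]
  refine ⟨fun x => Nat.size_le.2 ((hB.nreg x).trans_le (Nat.pow_le_pow_right (by norm_num) ?_)),
    fun a i j => Nat.size_le.2 ((hB.narr a i j).trans_le (Nat.pow_le_pow_right (by norm_num) ?_)),
    fun x => ?_, fun a i j => ?_⟩
  · omega
  · omega
  · obtain ⟨r, hr, hr'⟩ := (hB.rreg x).exists_rat (M.commonDen_pos d) hD
    exact ⟨r, hr, by omega⟩
  · obtain ⟨r, hr, hr'⟩ := (hB.rarr a i j).exists_rat (M.commonDen_pos d) hD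
    exact ⟨r, hr, by omega⟩

/-! ### Matchings, dual solutions and equilibria -/

namespace Market

variable {A S : Type} [Fintype A] [Fintype S] {M : Market A S}

open Classical in
/-- The dual value, distributed over the edges of a perfect matching. -/
theorem dualValue_eq_sum {F : Finset M.Edge} (hF : M.IsPerfectMatching F) (q : Vertex A S → ℝ) :
    M.dualValue q = ∑ e ∈ F, (q e.left + q e.right) := by
  have h1 : ∀ u : Vertex A S, (M.req u : ℝ) * q u
      = ∑ e ∈ F, if e.left = u ∨ e.right = u then q u else 0 := by
    intro u
    rw [← Finset.sum_filter, Finset.sum_const, nsmul_eq_mul, ← hF u]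
    push_cast
    congr!
  have h2 : ∀ e : M.Edge, ∑ u : Vertex A S, (if e.left = u ∨ e.right = u then q u else 0)
      = q e.left + q e.right := by
    intro e
    have hne : e.left ≠ e.right := by
      cases e <;> simp [Edge.left, Edge.right, flightNode, dummy, slotNode]
    rw [← Finset.sum_filter, ← Finset.sum_pair hne]
    congr 1
    ext u
    simp [eq_comm]
  rw [dualValue, Finset.sum_congr rfl fun u _ => h1 u, Finset.sum_comm]
  exact Finset.sum_congr rfl fun e _ => h2 e

theorem dualValue_le_weight {F : Finset M.Edge} {q : Vertex A S → ℝ} (hF : M.IsPerfectMatching F)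
    (hq : M.DualFeasible q) : M.dualValue q ≤ M.weight F := by
  rw [dualValue_eq_sum hF]
  exact Finset.sum_le_sum fun e _ => hq e

/-- Complementary slackness. -/
theorem tight_of_dualValue_eq {F : Finset M.Edge} {q : Vertex A S → ℝ}
    (hF : M.IsPerfectMatching F) (hq : M.DualFeasible q) (h : M.dualValue q = M.weight F) :
    ∀ e ∈ F, q e.left + q e.right = e.weight := by
  rw [dualValue_eq_sum hF] at h
  exact (Finset.sum_eq_sum_iff_of_le fun e _ => hq e).1 h

theorem optimal_of_dualValue_eq {F : Finset M.Edge} {q : Vertex A S → ℝ}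
    (hF : M.IsPerfectMatching F) (hq : M.DualFeasible q) (h : M.dualValue q = M.weight F) :
    M.IsMinMatching F ∧ M.IsDualOptimal q :=
  ⟨⟨hF, fun _ hF' => h ▸ dualValue_le_weight hF' hq⟩,
    ⟨hq, fun _ hq' => h ▸ dualValue_le_weight hF hq'⟩⟩

open Classical in
/-- The matching of an assignment: the special vertex takes up the capacity left over. -/
noncomputable def matchingOf (M : Market A S) (x : A → S) : Finset M.Edge :=
  Finset.univ.filter fun e => match e with
    | Sum.inl e => x e.1 = e.2.1
    | Sum.inr e => load x e.1 ≤ e.2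

theorem mem_matchingOf_inl {x : A → S} (i : A) (s : S) (h : s ∈ M.window i) :
    (Sum.inl ⟨i, s, h⟩ : M.Edge) ∈ M.matchingOf x ↔ x i = s := by
  simp [matchingOf]

theorem mem_matchingOf_inr {x : A → S} (s : S) (k : Fin (M.cap s)) :
    (Sum.inr ⟨s, k⟩ : M.Edge) ∈ M.matchingOf x ↔ load x s ≤ k := by
  simp [matchingOf]

/-- Sums over the matching of an assignment: one edge for every flight, and the unused copies of
the edges at the special vertex. -/
theorem sum_matchingOf {R : Type*} [AddCommMonoid R] {x : A → S} (hx : M.IsSchedule x)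
    (f : M.Edge → R) : ∑ e ∈ M.matchingOf x, f e
      = ∑ i, f (Sum.inl ⟨i, x i, hx.1 i⟩) +
        ∑ s, ∑ k : Fin (M.cap s), if load x s ≤ k then f (Sum.inr ⟨s, k⟩) else 0 := by
  classical
  rw [matchingOf, Finset.sum_filter, Fintype.sum_sum_type, Fintype.sum_sigma, Fintype.sum_sigma]
  congr 1
  · refine Finset.sum_congr rfl fun i _ => ?_
    rw [Finset.sum_eq_single (⟨x i, hx.1 i⟩ : {s // s ∈ M.window i})]
    · simp
    · rintro ⟨s, hs⟩ _ hne
      exact if_neg fun h => hne (Subtype.ext (Eq.symm h))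
    · simp
  · refine Finset.sum_congr rfl fun s _ => Finset.sum_congr rfl fun k _ => ?_
    by_cases h : load x s ≤ (k : ℕ)
    · exact (if_pos h).trans (if_pos h).symm
    · exact (if_neg h).trans (if_neg h).symm

theorem sum_unused {R : Type*} [Semiring R] (c l : ℕ) (r : R) :
    (∑ k : Fin c, if l ≤ (k : ℕ) then r else 0) = ((c - l : ℕ) : R) * r := by
  rw [Fin.sum_univ_eq_sum_range (fun k => if l ≤ k then r else 0), ← Finset.sum_filter,
    Finset.sum_const, nsmul_eq_mul]
  congr 2
  rw [← Nat.card_Ico]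
  congr 1
  ext k
  simp [and_comm]

theorem sum_load (x : A → S) : ∑ s, load x s = Fintype.card A := by
  classical
  rw [← Finset.card_univ,
    Finset.card_eq_sum_card_fiberwise (f := x) (t := Finset.univ) (fun _ _ => by simp)]
  simp only [load]

theorem isPerfectMatching_matchingOf {x : A → S} (hx : M.IsSchedule x) :
    M.IsPerfectMatching (M.matchingOf x) := by
  classical
  intro u
  have hle := hx.2
  have h : ∀ u : Vertex A S, (((M.matchingOf x).filter fun e => e.left = u ∨ e.right = u).card : ℤ)
      = M.req u := by
    intro u
    rw [Finset.card_filter]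
    push_cast
    rw [sum_matchingOf hx]
    simp only [Edge.left, Edge.right, flightNode, dummy, slotNode]
    match u with
    | Sum.inl (some i) => simp [req]
    | Sum.inl none =>
      simp only [req, reduceCtorEq, Sum.inl.injEq, or_false, if_false, if_true,
        Finset.sum_const_zero, zero_add, sum_unused, mul_one]
      rw [← sum_load x]
      push_cast
      rw [← Finset.sum_sub_distrib]
      exact Finset.sum_congr rfl fun s _ => by rw [Nat.cast_sub (hle s)]
    | Sum.inr s =>
      have e1 : ∀ s', (∑ k : Fin (M.cap s'), if load x s' ≤ (k : ℕ) then
          (if s' = s then (1 : ℤ) else 0) else 0) = if s' = s then (M.cap s : ℤ) - load x s else 0 := by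
        intro s'
        rw [sum_unused]
        split_ifs with h
        · rw [h, Nat.cast_sub (hle s), mul_one]
        · rw [mul_zero]
      simp only [req, reduceCtorEq, Sum.inr.injEq, false_or, e1]
      rw [Finset.sum_ite_eq' Finset.univ s, if_pos (Finset.mem_univ s), Finset.sum_boole]
      have : ((Finset.univ.filter fun i => x i = s).card : ℤ) = load x s := by
        simp only [load]
      rw [this]
      ring
  convert h u

/-- The dual solution with value `1` at the special vertex, the negative prices at the slots, and
at the flights what they pay. -/
def dualOf (M : Market A S) (x : A → S) (p : S → ℝ) : Vertex A S → ℝ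
  | Sum.inl (some i) => M.totalCost p i (x i)
  | Sum.inl none => 1
  | Sum.inr s => -p s

omit [Fintype S] in
theorem dualFeasible_dualOf {x : A → S} {p : S → ℝ} (h : M.IsEquilibrium x p) :
    M.DualFeasible (M.dualOf x p) := by
  rintro (⟨i, s, hs⟩ | ⟨s, k⟩)
  · have := h.min_cost i s hs
    simp only [totalCost] at this
    simp only [Edge.left, Edge.right, Edge.weight, flightNode, slotNode, dualOf, totalCost]
    linarith
  · have := h.price_nonneg s
    simp only [Edge.left, Edge.right, Edge.weight, dummy, slotNode, dualOf]
    linarith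

/-- An equilibrium consists of a matching and a dual solution of equal value. -/
theorem dualValue_dualOf {x : A → S} {p : S → ℝ} (h : M.IsEquilibrium x p) :
    M.dualValue (M.dualOf x p) = M.weight (M.matchingOf x) := by
  rw [dualValue_eq_sum (isPerfectMatching_matchingOf h.schedule)]
  refine Finset.sum_congr rfl ?_
  rintro (⟨i, s, hs⟩ | ⟨s, k⟩) he
  · rw [mem_matchingOf_inl] at he
    subst he
    simp only [Edge.left, Edge.right, Edge.weight, flightNode, slotNode, dualOf, totalCost]
    ring
  · rw [mem_matchingOf_inr] at he
    have := h.price_zero s (he.trans_lt k.2)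
    simp only [Edge.left, Edge.right, Edge.weight, dummy, slotNode, dualOf, this]
    ring

theorem exists_optimal {x : A → S} {p : S → ℝ} (h : M.IsEquilibrium x p) :
    ∃ F q, M.IsMinMatching F ∧ M.Describes F x ∧ M.IsDualOptimal q ∧ q dummy = 1 ∧
      (∀ s, p s = -q (slotNode s)) ∧ M.dualValue q = M.weight F := by
  have hv := dualValue_dualOf h
  obtain ⟨h1, h2⟩ := optimal_of_dualValue_eq (isPerfectMatching_matchingOf h.schedule)
    (dualFeasible_dualOf h) hv
  exact ⟨_, _, h1, fun i s hs => mem_matchingOf_inl i s hs, h2, rfl,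
    fun s => (neg_neg (p s)).symm, hv⟩

open Classical in
/-- A perfect matching describes a schedule, and has an edge `(v, s)` at every slot `s` that the
schedule does not fill. -/
theorem IsPerfectMatching.exists_schedule {F : Finset M.Edge} (hF : M.IsPerfectMatching F) :
    ∃ x, M.Describes F x ∧ M.IsSchedule x ∧
      ∀ s, load x s < M.cap s → ∃ k, (Sum.inr ⟨s, k⟩ : M.Edge) ∈ F := by
  have h1 : ∀ i : A, ∃ s : {s // s ∈ M.window i}, ∀ s' : {s // s ∈ M.window i},
      (Sum.inl ⟨i, s'⟩ : M.Edge) ∈ F ↔ s' = s := by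
    intro i
    have hc := hF (flightNode i)
    rw [show M.req (flightNode i) = 1 from rfl, Nat.cast_eq_one, Finset.card_eq_one] at hc
    obtain ⟨e, he⟩ := hc
    have hmem : ∀ e', e' ∈ F ∧ (e'.left = flightNode i ∨ e'.right = flightNode i) ↔ e' = e := by
      intro e'
      have := Finset.ext_iff.1 he e'
      simpa only [Finset.mem_filter, Finset.mem_singleton] using this
    rcases e with ⟨i', s⟩ | e
    · obtain ⟨-, h⟩ := (hmem _).2 rfl
      obtain rfl : i' = i := by simpa [Edge.left, Edge.right, flightNode, slotNode] using h
      refine ⟨s, fun s' => ?_⟩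
      have := hmem (Sum.inl ⟨i', s'⟩)
      simpa [Edge.left, Edge.right, flightNode, slotNode] using this
    · obtain ⟨-, h⟩ := (hmem _).2 rfl
      simp [Edge.left, Edge.right, flightNode, slotNode, dummy] at h
  choose x hx using h1
  -- the edges of the flights that land in a slot
  let T : S → Finset M.Edge := fun s =>
    (Finset.univ.filter fun i => (x i : S) = s).image fun i => Sum.inl ⟨i, x i⟩
  have hT : ∀ s, (T s).card = load (fun i => (x i : S)) s := by
    intro s
    rw [Finset.card_image_of_injective]
    · rfl
    · intro i j hij
      simp only [Sum.inl.injEq, Sigma.mk.injEq] at hij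
      exact hij.1
  have hsub : ∀ s, T s ⊆ F.filter fun e => e.left = slotNode s ∨ e.right = slotNode s := by
    intro s e he
    simp only [T, Finset.mem_image, Finset.mem_filter, Finset.mem_univ, true_and] at he
    obtain ⟨i, hi, rfl⟩ := he
    exact Finset.mem_filter.2 ⟨(hx i _).2 rfl, .inr (by simp [Edge.right, hi])⟩
  have hcard : ∀ s, (F.filter fun e => e.left = slotNode s ∨ e.right = slotNode s).card
      = M.cap s := by
    intro s
    have := hF (slotNode s)
    simp only [req, slotNode] at this
    exact_mod_cast this
  refine ⟨fun i => x i, fun i s h => ?_, ⟨fun i => (x i).2, fun s => ?_⟩, fun s hs => ?_⟩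
  · rw [hx i ⟨s, h⟩, Subtype.ext_iff, eq_comm]
  · rw [← hT, ← hcard]
    exact Finset.card_le_card (hsub s)
  · rw [← hT, ← hcard] at hs
    obtain ⟨e, he, heT⟩ := Finset.exists_mem_notMem_of_card_lt_card hs
    obtain ⟨heF, hes⟩ := Finset.mem_filter.1 he
    rcases e with ⟨i, s'⟩ | ⟨s', k⟩
    · obtain rfl := (hx i s').1 heF
      refine absurd (Finset.mem_image.2 ⟨i, ?_, rfl⟩) heT
      simpa [Edge.left, Edge.right, flightNode, slotNode] using hes
    · obtain rfl : s' = s := by simpa [Edge.left, Edge.right, dummy, slotNode] using hes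
      exact ⟨k, heF⟩

/-- Complementary slackness, read as the equilibrium conditions. -/
theorem exists_equilibrium {F : Finset M.Edge} {q : Vertex A S → ℝ} (hF : M.IsPerfectMatching F)
    (hq : M.DualFeasible q) (h : M.dualValue q = M.weight F) (h1 : q dummy = 1) :
    ∃ x, M.Describes F x ∧ M.IsEquilibrium x fun s => -q (slotNode s) := by
  have ht := tight_of_dualValue_eq hF hq h
  obtain ⟨x, hd, hs, hfree⟩ := hF.exists_schedule
  refine ⟨x, hd, hs, fun s => ?_, fun i s hsi => ?_, fun s hls => ?_⟩
  · have := hq (Sum.inr ⟨s, ⟨0, M.cap_pos s⟩⟩)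
    simp only [Edge.left, Edge.right, Edge.weight, h1] at this
    linarith
  · have e1 := ht _ ((hd i (x i) (hs.1 i)).2 rfl)
    have e2 := hq (Sum.inl ⟨i, s, hsi⟩)
    simp only [Edge.left, Edge.right, Edge.weight] at e1 e2
    simp only [totalCost]
    linarith
  · obtain ⟨k, hk⟩ := hfree s hls
    have := ht _ hk
    simp only [Edge.left, Edge.right, Edge.weight, h1] at this
    linarith

end Market

/-! ### The algorithm on the input of a market -/

theorem occ_eq_load {n m : ℕ} (x : Fin n → Fin m) {y : ℕ → ℕ} (hy : ∀ i : Fin n, y i = x i)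
    (s : Fin m) : occ n y s = Market.load x s := by
  classical
  rw [occ, Finset.card_filter,
    ← Fin.sum_univ_eq_sum_range (fun j => if y j = s then 1 else 0) n, ← Finset.card_filter]
  simp only [hy, Fin.val_inj, Market.load]
  congr!

namespace Market

variable {n m : ℕ} (M : Market (Fin n) (Fin m))

theorem input_cap (s : Fin m) : resid M.input s = M.cap s := by
  simp [resid, input]

theorem input_window (i : Fin n) (s : Fin m) :
    M.input.narr 1 i s = if s ∈ M.window i then 1 else 0 := by
  simp [input]

theorem input_cost (i : Fin n) (s : Fin m) (hs : s ∈ M.window i) :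
    M.input.rarr 0 i s = M.cost i s := by
  simp [input, hs]

theorem solvable_input {x : Fin n → Fin m} (hx : M.IsSchedule x) :
    Solvable n m (M.input.narr 1) (resid M.input) fun j => if h : j < n then x ⟨j, h⟩ else 0 := by
  refine ⟨fun j s => ?_, fun j hj => ?_, fun s hs => ?_⟩
  · simp only [input, one_ne_zero, if_false, if_true]
    split_ifs <;> omega
  · have h1 := M.input_window ⟨j, hj⟩ (x ⟨j, hj⟩)
    rw [if_pos (hx.1 _)] at h1
    simp only [hj, dif_pos]
    exact ⟨(x ⟨j, hj⟩).2, h1⟩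
  · have h1 := hx.2 ⟨s, hs⟩
    rw [← occ_eq_load x (y := fun j => if h : j < n then (x ⟨j, h⟩ : ℕ) else 0)
      (fun i => by simp), ← input_cap] at h1
    exact h1

/-- The last invariant of the algorithm says that the output is an equilibrium. -/
theorem isEquilibrium_of_phased {τ : Mem}
    (h : Phased n m (M.input.narr 1) (M.input.rarr 0) (resid M.input) 0 0 τ) :
    ∃ x p, IsOutput τ x p ∧ M.IsEquilibrium x p := by
  have hlt : ∀ j < n, asg τ j < m := by
    intro j hj
    refine lt_of_le_of_ne (h.part.le j hj) fun he => ?_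
    have h1 := h.balanced m le_rfl
    rw [if_neg (by omega), if_pos rfl] at h1
    have h2 : occ n (asg τ) m = 0 := by omega
    rw [occ, Finset.card_eq_zero, Finset.filter_eq_empty_iff] at h2
    exact h2 (Finset.mem_range.2 hj) he
  let x : Fin n → Fin m := fun i => ⟨asg τ i, hlt i i.2⟩
  have hwin : ∀ i, x i ∈ M.window i := by
    intro i
    have h1 : 1 ≤ M.input.narr 1 i (x i) := h.part.window i i.2 (hlt i i.2)
    rw [input_window] at h1
    by_contra hn
    rw [if_neg hn] at h1
    omega
  have hload : ∀ s : Fin m, load x s + resid τ s = M.cap s := by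
    intro s
    have h1 := h.balanced s s.2.le
    have := s.2
    rw [if_neg (by omega), if_neg (by omega), add_zero, input_cap] at h1
    rw [← occ_eq_load x (y := asg τ) (fun i => rfl), h1]
  refine ⟨x, fun s => price τ s, ⟨fun i => rfl, fun s => rfl⟩, ⟨hwin, fun s => ?_⟩,
    fun s => h.part.nonneg s s.2, fun i s hs => ?_, fun s hs => ?_⟩
  · have := hload s
    omega
  · have h1 := h.part.min_cost i i.2 s s.2 (by rw [input_window, if_pos hs])
    have h2 := M.input_cost i (x i) (hwin i)
    rw [input_cost M i s hs] at h1
    simp only [totalCost]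
    rw [← h2]
    change price τ (asg τ i) + M.input.rarr 0 i (asg τ i) ≤ _
    linarith
  · have := hload s
    exact h.part.price_zero s s.2 (by omega)

/-- The algorithm computes an equilibrium in the stated time. -/
theorem solve_spec (hM : M.Feasible) : ∃ t ≤ solveTime n m, ∃ τ, HaltsWith solve M.input t τ ∧
    ∃ x p, IsOutput τ x p ∧ M.IsEquilibrium x p := by
  obtain ⟨y, hy⟩ := hM
  have hcost : ∀ j s, 0 ≤ M.input.rarr 0 j s := by
    intro j s
    simp only [input, if_true]
    split_ifs with h1 h2
    exacts [M.cost_nonneg _ _ h2, le_rfl, le_rfl]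
  obtain ⟨t, τ, h1, h2, h3⟩ := run_solve (σ := M.input) (M.solvable_input hy) hcost
    (fun j => by simp [input]) rfl rfl rfl rfl rfl (fun _ _ => rfl) (by simp [resid, input])
    (fun s => by simp [price, input])
  rw [zero_add] at h2
  refine ⟨t, h2, τ, ?_, M.isEquilibrium_of_phased h3⟩
  have := h1 []
  rwa [List.append_nil] at this

end Market

open Polynomial in
theorem stronglyPolynomial_solve : StronglyPolynomial solve := by
  refine stronglyPolynomial_of_time
    (X * (X * (X * (X * 17 + 10) + X * 7 + 18) + 9 * X + 20 + 5) + 6) fun n m M hM => ?_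
  obtain ⟨t, ht, τ, hτ, -⟩ := M.solve_spec hM
  refine ⟨τ, iterate_of_haltsWith hτ (ht.trans ?_)⟩
  simp only [solveTime, phaseTime, eval_add, eval_mul, eval_X, eval_ofNat]
  have hn : n ≤ n + m := Nat.le_add_right _ _
  have hm : m ≤ n + m := Nat.le_add_left _ _
  gcongr

end Landing

theorem lemma2 :
    -- the reduction: minimum-weight perfect b-matchings and dual optima give equilibria
    (∀ (n m : ℕ) (M : Landing.Market (Fin n) (Fin m)),
      (M.Feasible →
        (∃ F, M.IsMinMatching F) ∧ ∃ q, M.IsDualOptimal q ∧ q Landing.Market.dummy = 1) ∧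
      ∀ F q, M.IsMinMatching F → M.IsDualOptimal q → q Landing.Market.dummy = 1 →
        ∃ x, M.Describes F x ∧ M.IsEquilibrium x (fun s => -q (Landing.Market.slotNode s))) ∧
    -- the algorithm
    ∃ P : Landing.Program, Landing.StronglyPolynomial P ∧
      ∀ (n m : ℕ) (M : Landing.Market (Fin n) (Fin m)), M.Feasible →
        ∃ t τ x p, Landing.HaltsWith P M.input t τ ∧ Landing.IsOutput τ x p ∧
          M.IsEquilibrium x p ∧
          ∃ F q, M.IsMinMatching F ∧ M.Describes F x ∧
            M.IsDualOptimal q ∧ q Landing.Market.dummy = 1 ∧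
            ∀ s, p s = -q (Landing.Market.slotNode s) := by
  refine ⟨fun n m M => ⟨fun hM => ?_, fun F q hF hq h1 => ?_⟩, Landing.solve,
    Landing.stronglyPolynomial_solve, fun n m M hM => ?_⟩
  · obtain ⟨-, -, -, -, x, p, -, he⟩ := M.solve_spec hM
    obtain ⟨F, q, hF, -, hq, hq1, -⟩ := Landing.Market.exists_optimal he
    exact ⟨⟨F, hF⟩, q, hq, hq1⟩
  · -- A perfect matching makes the market feasible, so that some pair has equal values; hence the
    -- optimal values agree.
    obtain ⟨y, -, hy, -⟩ := hF.1.exists_schedule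
    obtain ⟨-, -, -, -, x, p, -, he⟩ := M.solve_spec ⟨y, hy⟩
    obtain ⟨F₀, q₀, hF₀, -, hq₀, -, -, hv⟩ := Landing.Market.exists_optimal he
    refine Landing.Market.exists_equilibrium hF.1 hq.1 (le_antisymm
      (Landing.Market.dualValue_le_weight hF.1 hq.1) ?_) h1
    calc M.weight F ≤ M.weight F₀ := hF.2 F₀ hF₀.1
      _ = M.dualValue q₀ := hv.symm
      _ ≤ M.dualValue q := hq.2 q₀ hq₀.1
  · obtain ⟨t, -, τ, hτ, x, p, ho, he⟩ := M.solve_spec hM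
    obtain ⟨F, q, hF, hd, hq, hq1, hp, -⟩ := Landing.Market.exists_optimal he
    exact ⟨t, τ, x, p, hτ, ho, he, F, q, hF, hd, hq, hq1, hp⟩
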